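/- Let $M$ be a smooth $n$-manifold with frame bundle $\pi:FM\to M$ (frames at $x$ are the linear isomorphisms $\mathbb R^n\to T_xM$, and $Gl(n,\mathbb R)$ acts on the right). For open sets $U\subseteq M$, $U'\subseteq N$ of $n$-manifolds, a local principal bundle isomorphism $\Phi:FU\to FU'$ is a diffeomorphism $\pi^{-1}(U)\to\pi^{-1}(U')$ with $\Phi(X\cdot g)=\Phi(X)\cdot g$ for all $g\in Gl(n,\mathbb R)$; the map it induces on the bases is denoted by the corresponding small letter $\phi$. A diffeomorphism $f$ induces $Ff$, $X\mapsto T f\circ X$, and $\tau_v$ is the translation of $\mathbb R^n$ by $v$. Let $J^1(FM)$ be the groupoid over $FM$ of $1$-jets $j^1_{X,Y}\Theta$ (source $X$, target $Y=\Theta(X)$, derivative $T_X\Theta$) of local principal bundle isomorphisms $\Theta$ between open subbundles of $FM$, and let $\tilde J^1(FM)$ be its quotient by the action $(j^1_{X,Y}\Theta)\cdot g=j^1_{X\cdot g,Y\cdot g}\Theta$, a Lie groupoid over $M$ with source $\overline\alpha$ and target $\overline\beta$. The class of $j^1_{X,Y}\Theta$ is written $j^1_{x,y}\Theta$, where $x=\pi(X)$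 and $y=\pi(Y)$. Let $\Pi^1(M,M)$ be the Lie groupoid over $M$ of linear isomorphisms $T_xM\to T_yM$, i.e. of $1$-jets $j^1_{x,y}\psi$ of local diffeomorphisms of $M$. Sections are understood in the category of Lie groupoids: a section of $(\overline\alpha,\overline\beta)$ in $\tilde J^1(FM)$ (respectively of $(\alpha,\beta)$ in $\Pi^1(M,M)$) is a smooth groupoid morphism from the pair groupoid $M\times M$ whose value at $(x,y)$ has source $x$ and target $y$. For sections $\mathcal P,\mathcal Q$ of $\Pi^1(M,M)$, the second-order non-holonomic prolongation $\mathcal P^1(\mathcal Q)$ assigns to $(x,y)$ the class $j^1_{x,y}\Theta$, where $\mathcal Q(x,y)=j^1_{x,y}\psi$ for a local diffeomorphism $\psi:U\to V$ and $\Theta:FU\to FV$ sends a frame $X$ at $z$ to the frame $\mathcal P(z,\psi(z))\circ X$ at $\psi(z)$; the class does not depend on $\psi$. A section $\mathcal Q$ of $\Pi^1(M,M)$ is integrable if every point of $M$ has a neighbourhood $U$ with a chart $e:U\to\mathbb R^n$ such that $\mathcal Q(x,y)=j^1_{x,y}(e^{-1}\circ\tau_{e(y)-e(x)}\circ e)$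 for all $x,y\in U$. A second-order non-holonomic integrable prolongation is a section of the form $\mathcal P^1(\mathcal Q)$ with $\mathcal Q$ integrable. **Proposition.** Let $\overline{\mathcal P}$ be a section of $(\overline\alpha,\overline\beta)$ in $\tilde J^1(FM)$. Then $\overline{\mathcal P}$ is a second-order non-holonomic integrable prolongation if and only if for all $x_0,y_0\in M$ there exist open sets $U,V\subseteq M$ with $x_0\in U$, $y_0\in V$, open sets $\overline U,\overline V\subseteq\mathbb R^n$, and local principal bundle isomorphisms $\Phi:FU\to F\overline U$ and $\Psi:FV\to F\overline V$ such that $$\overline{\mathcal P}(x,y)=j^1_{x,y}\left(\Psi^{-1}\circ F\tau_{\psi(y)-\phi(x)}\circ\Phi\right)\qquad\text{for all }(x,y)\in U\times V .$$ -/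

import Mathlib

open Bundle Set TopologicalSpace
open scoped Manifold Topology ContDiff

noncomputable section

namespace NonHol

/-! ### One-jets -/

section OneJets

variable {EN : Type*} [NormedAddCommGroup EN] [NormedSpace ℝ EN]
  {HN : Type*} [TopologicalSpace HN] (I : ModelWithCorners ℝ EN HN)
  (N : Type*) [TopologicalSpace N] [ChartedSpace HN N]

/-- Candidates for `1`-jets of maps from `N` to `N`: a source, a target and a linear map between
the corresponding tangent spaces. -/
structure OneJet where
  src : N
  tgt : N
  lin : TangentSpace I src →L[ℝ] TangentSpace I tgt

variable {N}

/-- The `1`-jet of `f` at `x`. -/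
def oneJet (f : N → N) (x : N) : OneJet I N :=
  ⟨x, f x, mfderiv I I f x⟩

variable {I}

/-- A family of `1`-jets with parameters in a manifold `S` is smooth at `s`: the source, the target
and the coordinate expression of the linear part are smooth, that is, the family is smooth as a map
into the total space of the bundle with fibres `Hom (T_x N, T_y N)` over `N × N`. -/
def OneJet.SmoothAt [IsManifold I ∞ N]
    {ES : Type*} [NormedAddCommGroup ES] [NormedSpace ℝ ES]
    {HS : Type*} [TopologicalSpace HS] (J : ModelWithCorners ℝ ES HS)
    {S : Type*} [TopologicalSpace S] [ChartedSpace HS S]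
    (l : S → OneJet I N) (s : S) : Prop :=
  ContMDiffAt J I ∞ (fun t => (l t).src) s ∧
  ContMDiffAt J I ∞ (fun t => (l t).tgt) s ∧
  ContMDiffAt J 𝓘(ℝ, EN →L[ℝ] EN) ∞
    (fun t => ContinuousLinearMap.inCoordinates EN (TangentSpace I : N → Type _)
      EN (TangentSpace I : N → Type _) (l s).src (l t).src (l s).tgt (l t).tgt (l t).lin) s

end OneJets

/-! ### The frame bundle -/

/-- The model space `ℝⁿ`. -/
abbrev Eucl (n : ℕ) : Type := EuclideanSpace ℝ (Fin n)

/-- The general linear group of `ℝⁿ`. -/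
abbrev GLn (n : ℕ) : Type := Eucl n ≃L[ℝ] Eucl n

variable {n : ℕ} {M : Type*} [TopologicalSpace M] [ChartedSpace (Eucl n) M] [IsManifold (𝓡 n) ∞ M]
  {N : Type*} [TopologicalSpace N] [ChartedSpace (Eucl n) N] [IsManifold (𝓡 n) ∞ N]
  {K : Type*} [TopologicalSpace K] [ChartedSpace (Eucl n) K] [IsManifold (𝓡 n) ∞ K]

variable (n M) in
/-- The total space of the vector bundle over `M` with fibre `Hom (ℝⁿ, T_x M)` at `x`. -/
abbrev HomSpace : Type _ :=
  TotalSpace (Eucl n →L[ℝ] Eucl n)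
    (fun x : M => Bundle.Trivial M (Eucl n) x →L[ℝ] TangentSpace (𝓡 n) x)

theorem isOpen_frames : IsOpen {p : HomSpace n M | p.2.IsInvertible} := by
  rw [isOpen_iff_mem_nhds]
  intro p hp
  let e := trivializationAt (Eucl n →L[ℝ] Eucl n)
    (fun x : M => Bundle.Trivial M (Eucl n) x →L[ℝ] TangentSpace (𝓡 n) x) p.1
  have key : ∀ q : HomSpace n M, q ∈ e.source →
      ((e q).2.IsInvertible ↔ q.2.IsInvertible) := by
    intro q hq
    have hq' : q.1 ∈ (trivializationAt (Eucl n) (Bundle.Trivial M (Eucl n)) p.1).baseSet ∩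
        (trivializationAt (Eucl n) (TangentSpace (𝓡 n) : M → Type _) p.1).baseSet := hq
    have : (e q).2 = ContinuousLinearMap.inCoordinates (Eucl n) (Bundle.Trivial M (Eucl n))
        (Eucl n) (TangentSpace (𝓡 n) : M → Type _) p.1 q.1 p.1 q.1 q.2 := rfl
    rw [this, ContinuousLinearMap.inCoordinates_eq hq'.1 hq'.2,
      ContinuousLinearMap.isInvertible_equiv_comp, ContinuousLinearMap.isInvertible_comp_equiv]
  have hps : p ∈ e.source := FiberBundle.mem_trivializationAt_proj_source
  have hc : ContinuousAt (fun q => (e q).2) p := (e.continuousAt hps).snd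
  have ho : IsOpen {f : Eucl n →L[ℝ] Eucl n | f.IsInvertible} :=
    ContinuousLinearEquiv.isOpen (𝕜 := ℝ) (E := Eucl n) (F := Eucl n)
  filter_upwards [hc.preimage_mem_nhds (ho.mem_nhds ((key p hps).2 hp)),
    e.open_source.mem_nhds hps] with q h1 h2
  exact (key q h2).1 h1

variable (n M) in
/-- The frame bundle `FM`, the open submanifold of invertible elements of the bundle of
homomorphisms `ℝⁿ → T_x M`. A frame at `x` is a linear isomorphism `ℝⁿ → T_x M`. -/
abbrev FrameBundle : Type _ :=
  (⟨{p : HomSpace n M | p.2.IsInvertible}, isOpen_frames⟩ : Opens (HomSpace n M))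

/-- The model with corners of the frame bundle, modelled on `ℝⁿ × Hom (ℝⁿ, ℝⁿ)`. -/
abbrev FModel (n : ℕ) :
    ModelWithCorners ℝ (Eucl n × (Eucl n →L[ℝ] Eucl n))
      (ModelProd (Eucl n) (Eucl n →L[ℝ] Eucl n)) :=
  (𝓡 n).prod 𝓘(ℝ, Eucl n →L[ℝ] Eucl n)

namespace FrameBundle

/-- The projection `FM → M`. -/
def proj (X : FrameBundle n M) : M := X.1.1

/-- The frame at `x` given by a linear isomorphism `ℝⁿ → T_x M`. -/
def mk (x : M) (L : Eucl n ≃L[ℝ] TangentSpace (𝓡 n) x) : FrameBundle n M :=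
  ⟨⟨x, (L : Eucl n →L[ℝ] TangentSpace (𝓡 n) x)⟩, ⟨L, rfl⟩⟩

/-- The linear isomorphism `ℝⁿ → T_x M` given by a frame at `x`. -/
def iso (X : FrameBundle n M) : Eucl n ≃L[ℝ] TangentSpace (𝓡 n) X.proj :=
  Classical.choose X.2

theorem coe_iso (X : FrameBundle n M) :
    (X.iso : Eucl n →L[ℝ] TangentSpace (𝓡 n) X.proj) = X.1.2 :=
  Classical.choose_spec X.2

theorem mk_proj_iso (X : FrameBundle n M) : mk X.proj X.iso = X := by
  apply Subtype.ext
  have h := coe_iso X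
  obtain ⟨⟨x, L⟩, hL⟩ := X
  exact congrArg (TotalSpace.mk x) h

@[simp] theorem proj_mk (x : M) (L : Eucl n ≃L[ℝ] TangentSpace (𝓡 n) x) : (mk x L).proj = x := rfl

@[simp] theorem iso_mk (x : M) (L : Eucl n ≃L[ℝ] TangentSpace (𝓡 n) x) : (mk x L).iso = L :=
  ContinuousLinearEquiv.coe_injective (coe_iso (mk x L))

/-- The right action of the general linear group on frames. -/
def act (X : FrameBundle n M) (g : GLn n) : FrameBundle n M := mk X.proj (g.trans X.iso)

@[simp] theorem proj_act (X : FrameBundle n M) (g : GLn n) : (X.act g).proj = X.proj := rfl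

/-- The frame of the preferred chart at `x`. -/
def std (x : M) : FrameBundle n M :=
  mk x ((trivializationAt (Eucl n) (TangentSpace (𝓡 n) : M → Type _) x).continuousLinearEquivAt ℝ x
    (FiberBundle.mem_baseSet_trivializationAt' x)).symm

@[simp] theorem proj_std (x : M) : (std x : FrameBundle n M).proj = x := rfl

theorem contMDiff_proj : ContMDiff (FModel n) (𝓡 n) ∞ (proj : FrameBundle n M → M) :=
  (Bundle.contMDiff_proj _).comp contMDiff_subtype_val

/-- The map `Ff : FM → FN` induced by a diffeomorphism `f : M → N`, sending the frame `X` at `x` to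
the frame `T_x f ∘ X` at `f x`. -/
def lift (f : M ≃ₘ^∞⟮𝓡 n, 𝓡 n⟯ N) (X : FrameBundle n M) : FrameBundle n N :=
  mk (f X.proj) (X.iso.trans (f.mfderivToContinuousLinearEquiv (by simp) X.proj))

theorem contMDiff_lift (f : M ≃ₘ^∞⟮𝓡 n, 𝓡 n⟯ N) :
    ContMDiff (FModel n) (FModel n) ∞ (lift f : FrameBundle n M → FrameBundle n N) := by
  rw [← ContMDiff.subtypeVal_comp_iff]
  intro X₀
  rw [contMDiffAt_hom_bundle]
  refine ⟨(f.contMDiff.comp contMDiff_proj).contMDiffAt, ?_⟩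
  have h1 : ContMDiffAt (FModel n) 𝓘(ℝ, Eucl n →L[ℝ] Eucl n) ∞
      (fun X : FrameBundle n M => inTangentCoordinates (𝓡 n) (𝓡 n) id f
        (fun x => mfderiv (𝓡 n) (𝓡 n) f x) X₀.proj X.proj) X₀ :=
    ContMDiffAt.comp X₀ (f.contMDiff.contMDiffAt.mfderiv_const (m := ∞) (by simp))
      contMDiff_proj.contMDiffAt
  have h2 := ((contMDiffAt_hom_bundle (n := ∞) (IB := 𝓡 n) (IM := FModel n)
    (fun X : FrameBundle n M => (X.1 : HomSpace n M)) (x₀ := X₀)).1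
      contMDiff_subtype_val.contMDiffAt).2
  refine (h1.clm_comp h2).congr_of_eventuallyEq ?_
  have hb : ∀ᶠ X : FrameBundle n M in 𝓝 X₀,
      X.proj ∈ (trivializationAt (Eucl n) (TangentSpace (𝓡 n) : M → Type _) X₀.proj).baseSet :=
    contMDiff_proj.continuous.continuousAt.preimage_mem_nhds
      ((trivializationAt _ _ _).open_baseSet.mem_nhds (FiberBundle.mem_baseSet_trivializationAt' _))
  filter_upwards [hb] with X hX
  have hv : (X.1 : HomSpace n M).2 = (X.iso : Eucl n →L[ℝ] TangentSpace (𝓡 n) X.proj) :=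
    (coe_iso X).symm
  change ContinuousLinearMap.inCoordinates _ _ _ _ _ _ _ _ _ = 
    (ContinuousLinearMap.inCoordinates _ _ _ _ _ _ _ _ _).comp
    (ContinuousLinearMap.inCoordinates _ _ _ _ _ _ _ _ _)
  rw [hv]
  refine ContinuousLinearMap.ext fun v => ?_
  have e := (trivializationAt (Eucl n) (TangentSpace (𝓡 n) : M → Type _)
    X₀.proj).symmL_continuousLinearMapAt (R := ℝ) hX (X.iso v)
  have ht : (trivializationAt (Eucl n) (Bundle.Trivial M (Eucl n)) X₀.proj).symmL ℝ X.proj v = v :=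
    DFunLike.congr_fun (Bundle.Trivial.symmL_trivialization ℝ M (Eucl n) X.proj) v
  have ht' : (trivializationAt (Eucl n) (Bundle.Trivial N (Eucl n)) (f X₀.proj)).symmL ℝ
      (f X.proj) v = v :=
    DFunLike.congr_fun (Bundle.Trivial.symmL_trivialization ℝ N (Eucl n) (f X.proj)) v
  change (trivializationAt (Eucl n) (TangentSpace (𝓡 n) : N → Type _)
      (f X₀.proj)).continuousLinearMapAt ℝ (f X.proj) (mfderiv (𝓡 n) (𝓡 n) f X.proj
        (X.iso ((trivializationAt (Eucl n) (Bundle.Trivial N (Eucl n)) (f X₀.proj)).symmL ℝ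
          (f X.proj) v))) =
    (trivializationAt (Eucl n) (TangentSpace (𝓡 n) : N → Type _)
      (f X₀.proj)).continuousLinearMapAt ℝ (f X.proj) (mfderiv (𝓡 n) (𝓡 n) f X.proj
      ((trivializationAt (Eucl n) (TangentSpace (𝓡 n) : M → Type _) X₀.proj).symmL ℝ X.proj
        ((trivializationAt (Eucl n) (TangentSpace (𝓡 n) : M → Type _)
          X₀.proj).continuousLinearMapAt ℝ X.proj
        (X.iso ((trivializationAt (Eucl n) (Bundle.Trivial M (Eucl n)) X₀.proj).symmL ℝ X.proj v)))))
  rw [ht, ht', e]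

theorem lift_act (f : M ≃ₘ^∞⟮𝓡 n, 𝓡 n⟯ N) (X : FrameBundle n M) (g : GLn n) :
    lift f (X.act g) = (lift f X).act g := by
  simp only [lift, act, iso_mk, proj_mk]
  rfl

theorem lift_symm_lift (f : M ≃ₘ^∞⟮𝓡 n, 𝓡 n⟯ N) (X : FrameBundle n M) :
    lift f.symm (lift f X) = X := by
  let G : (M → M) → HomSpace n M := fun h =>
    ⟨h X.proj, (mfderiv (𝓡 n) (𝓡 n) h X.proj).comp
      (X.iso : Eucl n →L[ℝ] TangentSpace (𝓡 n) X.proj)⟩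
  have hid : f.symm ∘ f = id := funext f.symm_apply_apply
  have h1 : G (f.symm ∘ f) = (lift f.symm (lift f X)).1 := by
    simp only [G, lift, iso_mk, proj_mk]
    rw [mfderiv_comp (I' := 𝓡 n) X.proj (f.symm.mdifferentiable (by simp) _)
      (f.mdifferentiable (by simp) _)]
    rfl
  have h2 : G id = X.1 := by
    simp only [G]
    rw [mfderiv_id]
    exact congrArg Subtype.val (mk_proj_iso X)
  exact Subtype.ext (h1.symm.trans ((congrArg G hid).trans h2))

end FrameBundle

/-! ### Local principal bundle isomorphisms -/

variable (n M N) in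
/-- A local principal bundle isomorphism `FU → FV` between open subbundles `FU ⊆ FM`, `FV ⊆ FN`
(over the identity of the general linear group): a diffeomorphism between open subsets which are
invariant under the general linear group, commuting with the action. -/
structure LocalIso extends OpenPartialHomeomorph (FrameBundle n M) (FrameBundle n N) where
  contMDiffOn_toFun : ContMDiffOn (FModel n) (FModel n) ∞ toFun source
  contMDiffOn_invFun : ContMDiffOn (FModel n) (FModel n) ∞ invFun target
  act_mem_source : ∀ X ∈ source, ∀ g : GLn n, X.act g ∈ source
  map_act : ∀ X ∈ source, ∀ g : GLn n, toFun (X.act g) = (toFun X).act g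

namespace LocalIso

/-- The underlying map of a local isomorphism. -/
def map (Φ : LocalIso n M N) : FrameBundle n M → FrameBundle n N := Φ.toFun

/-- The map `φ` induced by a local isomorphism `Φ` on the base manifolds, `φ (π X) = π (Φ X)`. -/
def base (Φ : LocalIso n M N) (x : M) : N := (Φ.map (FrameBundle.std x)).proj

/-- The inverse local isomorphism. -/
def symm (Φ : LocalIso n M N) : LocalIso n N M where
  toOpenPartialHomeomorph := Φ.toOpenPartialHomeomorph.symm
  contMDiffOn_toFun := Φ.contMDiffOn_invFun
  contMDiffOn_invFun := Φ.contMDiffOn_toFun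
  act_mem_source Y hY g := by
    have h1 : Φ.toFun ((Φ.invFun Y).act g) = (Φ.toFun (Φ.invFun Y)).act g :=
      Φ.map_act _ (Φ.map_target hY) g
    rw [Φ.right_inv' hY] at h1
    exact h1 ▸ Φ.map_source (Φ.act_mem_source _ (Φ.map_target hY) g)
  map_act Y hY g := by
    have h1 : Φ.toFun ((Φ.invFun Y).act g) = (Φ.toFun (Φ.invFun Y)).act g :=
      Φ.map_act _ (Φ.map_target hY) g
    rw [Φ.right_inv' hY] at h1
    change Φ.invFun (Y.act g) = (Φ.invFun Y).act g
    rw [← h1]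
    exact Φ.left_inv' (Φ.act_mem_source _ (Φ.map_target hY) g)

/-- The composition `Ψ ∘ Φ` of local isomorphisms, defined wherever it makes sense. -/
def trans (Φ : LocalIso n M N) (Ψ : LocalIso n N K) : LocalIso n M K where
  toOpenPartialHomeomorph := Φ.toOpenPartialHomeomorph.trans Ψ.toOpenPartialHomeomorph
  contMDiffOn_toFun := Ψ.contMDiffOn_toFun.comp (Φ.contMDiffOn_toFun.mono fun _ h => h.1)
    fun _ h => h.2
  contMDiffOn_invFun := Φ.contMDiffOn_invFun.comp (Ψ.contMDiffOn_invFun.mono fun _ h => h.1)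
    fun _ h => h.2
  act_mem_source X hX g := by
    refine ⟨Φ.act_mem_source X hX.1 g, ?_⟩
    change Φ.toFun (X.act g) ∈ Ψ.source
    rw [Φ.map_act X hX.1 g]
    exact Ψ.act_mem_source _ hX.2 g
  map_act X hX g := by
    change Ψ.toFun (Φ.toFun (X.act g)) = (Ψ.toFun (Φ.toFun X)).act g
    rw [Φ.map_act X hX.1 g]
    exact Ψ.map_act _ hX.2 g

/-- The isomorphism `Ff : FM → FN` induced by a diffeomorphism `f : M → N`. -/
def ofDiffeomorph (f : M ≃ₘ^∞⟮𝓡 n, 𝓡 n⟯ N) : LocalIso n M N where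
  toOpenPartialHomeomorph :=
    { toFun := FrameBundle.lift f
      invFun := FrameBundle.lift f.symm
      source := univ
      target := univ
      map_source' := fun _ _ => mem_univ _
      map_target' := fun _ _ => mem_univ _
      left_inv' := fun X _ => FrameBundle.lift_symm_lift f X
      right_inv' := fun X _ => FrameBundle.lift_symm_lift f.symm X
      open_source := isOpen_univ
      open_target := isOpen_univ
      continuousOn_toFun := (FrameBundle.contMDiff_lift f).continuous.continuousOn
      continuousOn_invFun := (FrameBundle.contMDiff_lift f.symm).continuous.continuousOn }
  contMDiffOn_toFun := (FrameBundle.contMDiff_lift f).contMDiffOn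
  contMDiffOn_invFun := (FrameBundle.contMDiff_lift f.symm).contMDiffOn
  act_mem_source _ _ _ := mem_univ _
  map_act X _ g := FrameBundle.lift_act f X g

end LocalIso

/-- The translation `τ_v : ℝⁿ → ℝⁿ`, `w ↦ w + v`. -/
def translation (v : Eucl n) : Eucl n ≃ₘ^∞⟮𝓡 n, 𝓡 n⟯ Eucl n where
  toEquiv := Equiv.addRight v
  contMDiff_toFun := (contDiff_id.add contDiff_const).contMDiff
  contMDiff_invFun := (contDiff_id.add contDiff_const).contMDiff

/-! ### The second-order non-holonomic groupoid -/

variable (n M) in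
/-- The groupoid `J¹(FM)` over `FM` of `1`-jets of local automorphisms of `FM`. -/
abbrev JetGroupoid : Type _ :=
  {j : OneJet (FModel n) (FrameBundle n M) //
    ∃ (Θ : LocalIso n M M) (X : FrameBundle n M), X ∈ Θ.source ∧ j = oneJet (FModel n) Θ.map X}

/-- Two jets lie in the same orbit of the action `(j¹_{X,Y} Θ) · g = j¹_{X·g,Y·g} Θ`. -/
def SameOrbit (j j' : JetGroupoid n M) : Prop :=
  ∃ (Θ : LocalIso n M M) (X : FrameBundle n M) (g : GLn n), X ∈ Θ.source ∧
    j.1 = oneJet (FModel n) Θ.map X ∧ j'.1 = oneJet (FModel n) Θ.map (X.act g)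

variable (n M) in
/-- The second-order non-holonomic groupoid over `M`, the quotient of `J¹(FM)` by the action of
the general linear group. -/
def NonholonomicGroupoid : Type _ := Quot (SameOrbit (n := n) (M := M))

namespace NonholonomicGroupoid

/-- The class of an element of `J¹(FM)`. -/
def mk (j : JetGroupoid n M) : NonholonomicGroupoid n M := Quot.mk _ j

/-- The source map. -/
def src : NonholonomicGroupoid n M → M :=
  Quot.lift (fun j => j.1.src.proj) (by
    rintro j j' ⟨Θ, X, g, -, h, h'⟩
    simp only [h, h']
    rfl)

/-- The target map. -/
def tgt : NonholonomicGroupoid n M → M :=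
  Quot.lift (fun j => j.1.tgt.proj) (by
    rintro j j' ⟨Θ, X, g, hX, h, h'⟩
    simp only [h, h']
    change (Θ.toFun X).proj = (Θ.toFun (X.act g)).proj
    rw [Θ.map_act X hX g, FrameBundle.proj_act])

end NonholonomicGroupoid

/-- The element `j¹_{x,y} Θ` of the second-order non-holonomic groupoid, where `y` is the image of
`x` under the map induced by `Θ` on `M`, for a local automorphism `Θ` defined over `x`. -/
def LocalIso.jet (Θ : LocalIso n M M) (x : M) (hx : FrameBundle.std x ∈ Θ.source) :
    NonholonomicGroupoid n M :=
  .mk ⟨oneJet (FModel n) Θ.map (FrameBundle.std x), Θ, _, hx, rfl⟩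

/-- `c = b · a` in the second-order non-holonomic groupoid: `a = j¹_{x,y} Θ`, `b = j¹_{y,z} Ξ` and
`c = j¹_{x,z} (Ξ ∘ Θ)` for some local automorphisms `Θ` and `Ξ`. -/
def NonholonomicGroupoid.IsComp (c b a : NonholonomicGroupoid n M) : Prop :=
  ∃ (Θ Ξ : LocalIso n M M) (x : M) (hΘ : FrameBundle.std x ∈ Θ.source)
    (hΞ : FrameBundle.std (Θ.base x) ∈ Ξ.source)
    (hΘΞ : FrameBundle.std x ∈ (Θ.trans Ξ).source),
    a = Θ.jet x hΘ ∧ b = Ξ.jet (Θ.base x) hΞ ∧ c = (Θ.trans Ξ).jet x hΘΞ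

/-! ### Sections -/

variable (n M) in
/-- A section of `(α, β)` in the `1`-jets groupoid `Π¹(M, M)` (the groupoid of linear isomorphisms
between tangent spaces), in the category of Lie groupoids: a smooth groupoid morphism
`M × M → Π¹(M, M)` which assigns to `(x, y)` a linear isomorphism `T_x M → T_y M`. -/
structure PiSection where
  toFun : ∀ x y : M, TangentSpace (𝓡 n) x ≃L[ℝ] TangentSpace (𝓡 n) y
  smooth : ∀ p : M × M, OneJet.SmoothAt ((𝓡 n).prod (𝓡 n))
    (fun q : M × M => (⟨q.1, q.2, toFun q.1 q.2⟩ : OneJet (𝓡 n) M)) p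
  comp : ∀ x y z : M, (toFun x y).trans (toFun y z) = toFun x z

/-- The value of a section at `(x, y)`, as a `1`-jet. -/
def PiSection.jet (Q : PiSection n M) (x y : M) : OneJet (𝓡 n) M := ⟨x, y, Q.toFun x y⟩

/-- A section of `Π¹(M, M)` is integrable: around every point there is a local chart `e` such that
the section equals `j¹_{x,y} (e⁻¹ ∘ τ_{e y - e x} ∘ e)` on the domain of `e`. -/
def PiSection.IsIntegrable (Q : PiSection n M) : Prop :=
  ∀ x₀ : M, ∃ e ∈ IsManifold.maximalAtlas (𝓡 n) ∞ M, x₀ ∈ e.source ∧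
    ∀ x ∈ e.source, ∀ y ∈ e.source,
      Q.jet x y = oneJet (𝓡 n) (e.symm ∘ translation (e y - e x) ∘ e) x

variable (n M) in
/-- A section of the map (source, target) of the second-order non-holonomic groupoid, in the
category of Lie groupoids: a smooth groupoid morphism from the pair groupoid `M × M`. Smoothness
for the quotient manifold structure is the existence of local smooth lifts to `J¹(FM)`. -/
structure NonholonomicSection where
  toFun : M → M → NonholonomicGroupoid n M
  src_eq : ∀ x y, (toFun x y).src = x
  tgt_eq : ∀ x y, (toFun x y).tgt = y
  smooth : ∀ p₀ : M × M, ∃ W ∈ 𝓝 p₀, ∃ l : M × M → JetGroupoid n M, ∀ p ∈ W,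
    toFun p.1 p.2 = .mk (l p) ∧
      OneJet.SmoothAt ((𝓡 n).prod (𝓡 n)) (fun q => (l q).1) p
  comp : ∀ x y z, (toFun x z).IsComp (toFun y z) (toFun x y)

/-- The section `R` is the second-order non-holonomic prolongation of `P` and `Q`: for all `x, y`,
writing `Q (x, y) = j¹_{x,y} ψ` for a local diffeomorphism `ψ : U → V`, the value `R (x, y)` is
`j¹_{x,y} Θ` where `Θ : FU → FV` sends a frame `X` at `z` to the frame `P (z, ψ z) · X` at `ψ z`. -/
def NonholonomicSection.IsProlongationOf (R : NonholonomicSection n M) (P Q : PiSection n M) :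
    Prop :=
  ∀ x y : M, ∃ (ψ : OpenPartialHomeomorph M M) (Θ : LocalIso n M M),
    ContMDiffOn (𝓡 n) (𝓡 n) ∞ ψ ψ.source ∧ ContMDiffOn (𝓡 n) (𝓡 n) ∞ ψ.symm ψ.target ∧
    x ∈ ψ.source ∧ Q.jet x y = oneJet (𝓡 n) ψ x ∧
    Θ.source = FrameBundle.proj ⁻¹' ψ.source ∧
    (∀ X ∈ Θ.source,
      Θ.map X = FrameBundle.mk (ψ X.proj) (X.iso.trans (P.toFun X.proj (ψ X.proj)))) ∧
    ∃ hx, R.toFun x y = Θ.jet x hx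

/-- The section is a second-order non-holonomic integrable prolongation. -/
def NonholonomicSection.IsIntegrableProlongation (R : NonholonomicSection n M) : Prop :=
  ∃ P Q : PiSection n M, R.IsProlongationOf P Q ∧ Q.IsIntegrable

end NonHol

end

open NonHol

/-! An element `j¹_{x,y} Θ` of the non-holonomic groupoid has two shadows in `Π¹(M, M)`: the
isomorphism `T_x M → T_y M` by which `Θ` acts on frames (`frame`, through `fiber`), and the
derivative at `x` of the base map of `Θ` (`baseMap`). For a prolongation of `P` and `Q` these
shadows are `P` and `Q`, and the remaining information in the jet is determined by them: the jet of
`X ↦ P (z, ψ z) · X` depends on `ψ` only through its `1`-jet (`oneJet_eq_moveJet`).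

From integrable prolongation to translations: a groupoid morphism `P` on the pair groupoid is a
global parallelism. Carrying every tangent space to a fixed one by `P`, and reading it there in a
fixed frame, gives `toModel`, which is invariant under `P`. Together with a chart it turns frames on
`M` into frames on `ℝⁿ`. The derivative of a translation is the identity, so `Ψ⁻¹ ∘ Fτ ∘ Φ` built in
this way is precisely the action of `P` over the map `f⁻¹ ∘ τ ∘ e` (`frameMapInv_lift_frameMap`).
What remains is to write `Q` through translations between two charts, one near each point; a linear
change of one of the integrable charts achieves this (`IsIntegrable.exists_charts`).

From translations to integrable prolongation: let `P` and `Q` be the two shadows of `R`. They are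
morphisms because both projections respect composition, and their smoothness is read off the local
form (`smoothAt_frameEquiv`, `smoothAt_baseEquiv`). If `Θ = Ψ⁻¹ ∘ Fτ_v ∘ Φ` sends the fibre over `z`
to that over `w`, then `ψ w - φ z = v`, so the same `Θ` also represents `R (z, w)`; hence `Θ` acts
on frames by `P` at every point of its domain, not only at the chosen one. Integrability comes from
the local form at `(x₀, x₀)`: since `Q (y, y) = id`, the derivatives of `φ` and `ψ` agree on `U ∩
V`, and `φ` is the required chart (`jet_eq_oneJet_base`). -/

noncomputable section

namespace NonHol

variable {n : ℕ} {M : Type*} [TopologicalSpace M] [ChartedSpace (Eucl n) M] [IsManifold (𝓡 n) ∞ M]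
  {N : Type*} [TopologicalSpace N] [ChartedSpace (Eucl n) N] [IsManifold (𝓡 n) ∞ N]
  {K : Type*} [TopologicalSpace K] [ChartedSpace (Eucl n) K] [IsManifold (𝓡 n) ∞ K]
  {ES : Type*} [NormedAddCommGroup ES] [NormedSpace ℝ ES]
  {HS : Type*} [TopologicalSpace HS] {J : ModelWithCorners ℝ ES HS}
  {S : Type*} [TopologicalSpace S] [ChartedSpace HS S]

/-! ### Frames in coordinates -/

/-- Two `1`-jets agree as soon as their sources, their targets and their linear parts, read in the
model space, agree. -/
theorem OneJet.ext_model {EN : Type*} [NormedAddCommGroup EN] [NormedSpace ℝ EN]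
    {HN : Type*} [TopologicalSpace HN] {I : ModelWithCorners ℝ EN HN}
    {Q : Type*} [TopologicalSpace Q] [ChartedSpace HN Q] {j j' : OneJet I Q}
    (h1 : j.src = j'.src) (h2 : j.tgt = j'.tgt)
    (h3 : (j.lin : EN →L[ℝ] EN) = (j'.lin : EN →L[ℝ] EN)) : j = j' := by
  obtain ⟨a, b, l⟩ := j
  obtain ⟨a', b', l'⟩ := j'
  obtain rfl : a = a' := h1
  obtain rfl : b = b' := h2
  obtain rfl : l = l' := h3
  rfl

/-- The trivialization of the tangent bundle given by the preferred chart at `x`. -/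
abbrev tanTriv (x : M) : Trivialization (Eucl n) (π (Eucl n) (TangentSpace (𝓡 n) : M → Type _)) :=
  trivializationAt (Eucl n) (TangentSpace (𝓡 n) : M → Type _) x

theorem eventually_mem_tanTriv {f : S → M} {s : S} (hf : ContinuousAt f s) :
    ∀ᶠ t in 𝓝 s, f t ∈ (tanTriv (n := n) (f s)).baseSet :=
  hf.preimage_mem_nhds
    ((tanTriv (f s)).open_baseSet.mem_nhds (FiberBundle.mem_baseSet_trivializationAt' _))

namespace FrameBundle

/-- All tangent spaces are definitionally the model space, so frames over propositionally equal
points can be compared there without transport. -/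
theorem ext_mk {x y : M} {L : Eucl n ≃L[ℝ] TangentSpace (𝓡 n) x}
    {L' : Eucl n ≃L[ℝ] TangentSpace (𝓡 n) y} (h : x = y)
    (hL : ∀ v, (L v : Eucl n) = (L' v : Eucl n)) : mk x L = mk y L' := by
  subst h
  exact congrArg (mk x) (ContinuousLinearEquiv.ext (funext hL))

/-- The matrix of the frame `X` in the preferred chart at `x`. -/
def coord (x : M) (X : FrameBundle n M) : Eucl n →L[ℝ] Eucl n :=
  ((tanTriv x).continuousLinearMapAt ℝ X.proj).comp
    (X.iso : Eucl n →L[ℝ] TangentSpace (𝓡 n) X.proj)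

theorem inCoordinates_eq_coord (x : M) (X : FrameBundle n M) :
    ContinuousLinearMap.inCoordinates (Eucl n) (Bundle.Trivial M (Eucl n)) (Eucl n)
      (TangentSpace (𝓡 n) : M → Type _) x X.1.1 x X.1.1 X.1.2 = coord x X := by
  have hv : (X.1 : HomSpace n M).2 = (X.iso : Eucl n →L[ℝ] TangentSpace (𝓡 n) X.proj) :=
    (coe_iso X).symm
  rw [hv]
  refine ContinuousLinearMap.ext fun v => ?_
  have ht : (trivializationAt (Eucl n) (Bundle.Trivial M (Eucl n)) x).symmL ℝ X.proj v = v :=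
    DFunLike.congr_fun (Bundle.Trivial.symmL_trivialization ℝ M (Eucl n) X.proj) v
  change (tanTriv x).continuousLinearMapAt ℝ X.proj
    (X.iso ((trivializationAt (Eucl n) (Bundle.Trivial M (Eucl n)) x).symmL ℝ X.proj v)) =
    (tanTriv x).continuousLinearMapAt ℝ X.proj (X.iso v)
  rw [ht]

/-- A map into the frame bundle is smooth if and only if its projection and its matrix are. -/
theorem contMDiffAt_frameBundle_iff {f : S → FrameBundle n M} {s : S} :
    ContMDiffAt J (FModel n) ∞ f s ↔ ContMDiffAt J (𝓡 n) ∞ (fun t => (f t).proj) s ∧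
      ContMDiffAt J 𝓘(ℝ, Eucl n →L[ℝ] Eucl n) ∞ (fun t => coord (f s).proj (f t)) s := by
  rw [← ContMDiffAt.subtypeVal_comp_iff, contMDiffAt_hom_bundle]
  simp only [Function.comp_apply, inCoordinates_eq_coord]
  rfl

/-- The trivialization at `x₀` cancels against its inverse at `x`. The one at `y₀` enters both sides
identically, so `y` may lie outside its domain. -/
theorem coord_mk_trans {x₀ y₀ x y : M} {A : TangentSpace (𝓡 n) x ≃L[ℝ] TangentSpace (𝓡 n) y}
    {L : Eucl n ≃L[ℝ] TangentSpace (𝓡 n) x} (hx : x ∈ (tanTriv (n := n) x₀).baseSet) :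
    coord y₀ (mk y (L.trans A)) =
      (ContinuousLinearMap.inCoordinates (Eucl n) (TangentSpace (𝓡 n) : M → Type _)
        (Eucl n) (TangentSpace (𝓡 n) : M → Type _) x₀ x y₀ y
        (A : TangentSpace (𝓡 n) x →L[ℝ] TangentSpace (𝓡 n) y)).comp (coord x₀ (mk x L)) := by
  refine ContinuousLinearMap.ext fun v => ?_
  have e := (tanTriv x₀).symmL_continuousLinearMapAt (R := ℝ) hx (L v)
  simp only [coord, iso_mk]
  change (tanTriv y₀).continuousLinearMapAt ℝ y (A (L v)) =
    (tanTriv y₀).continuousLinearMapAt ℝ y (A ((tanTriv x₀).symmL ℝ x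
      ((tanTriv x₀).continuousLinearMapAt ℝ x (L v))))
  rw [e]

/-- The matrix of a frame over the domain of the preferred chart at `x`, as an isomorphism. -/
def coordEquiv (x : M) (X : FrameBundle n M) (h : X.proj ∈ (tanTriv (n := n) x).baseSet) : GLn n :=
  X.iso.trans ((tanTriv x).continuousLinearEquivAt ℝ X.proj h)

theorem coe_coordEquiv (x : M) (X : FrameBundle n M) (h : X.proj ∈ (tanTriv (n := n) x).baseSet) :
    (coordEquiv x X h : Eucl n →L[ℝ] Eucl n) = coord x X := by
  refine ContinuousLinearMap.ext fun v => ?_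
  change (tanTriv x).continuousLinearEquivAt ℝ X.proj h (X.iso v) =
    (tanTriv x).continuousLinearMapAt ℝ X.proj (X.iso v)
  rw [← (tanTriv x).coe_continuousLinearEquivAt_eq (R := ℝ) h]

open Classical in
/-- The section of the frame bundle through `X` which has constant matrix near `X`. -/
def constSection (X : FrameBundle n M) (z : M) : FrameBundle n M :=
  if h : z ∈ (tanTriv (n := n) X.proj).baseSet then
    mk z ((coordEquiv X.proj X (FiberBundle.mem_baseSet_trivializationAt' _)).trans
      ((tanTriv X.proj).continuousLinearEquivAt ℝ z h).symm)
  -- The value off the trivializing domain keeps this a set-theoretic section everywhere, so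
  -- `proj_constSection` needs no hypothesis.
  else std z

@[simp] theorem proj_constSection (X : FrameBundle n M) (z : M) : (constSection X z).proj = z := by
  unfold constSection
  split_ifs <;> rfl

@[simp] theorem constSection_self (X : FrameBundle n M) : constSection X X.proj = X := by
  have h : X.proj ∈ (tanTriv (n := n) X.proj).baseSet :=
    FiberBundle.mem_baseSet_trivializationAt' _
  refine Eq.trans ?_ (mk_proj_iso X)
  rw [constSection, dif_pos h]
  refine congrArg (mk X.proj) (ContinuousLinearEquiv.ext (funext fun v => ?_))
  exact ((tanTriv X.proj).continuousLinearEquivAt ℝ X.proj h).symm_apply_apply (X.iso v)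

theorem coord_constSection (X : FrameBundle n M) {z : M}
    (h : z ∈ (tanTriv (n := n) X.proj).baseSet) :
    coord X.proj (constSection X z) = coord X.proj X := by
  rw [constSection, dif_pos h, ← coe_coordEquiv _ _ h, ← coe_coordEquiv X.proj X
    (FiberBundle.mem_baseSet_trivializationAt' _)]
  refine congrArg _ (ContinuousLinearEquiv.ext (funext fun v => ?_))
  simp only [coordEquiv, iso_mk]
  exact ((tanTriv X.proj).continuousLinearEquivAt ℝ z h).apply_symm_apply _

/-- Provides a smooth local section through any prescribed frame. Maps on `FM` are pushed down to
`M` along it; `std` cannot serve, since the preferred chart may jump from point to point. -/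
theorem contMDiffAt_constSection (X : FrameBundle n M) :
    ContMDiffAt (𝓡 n) (FModel n) ∞ (constSection X) X.proj := by
  rw [contMDiffAt_frameBundle_iff]
  simp only [proj_constSection]
  refine ⟨contMDiffAt_id, ?_⟩
  refine (contMDiffAt_const (c := coord X.proj X)).congr_of_eventuallyEq ?_
  filter_upwards [eventually_mem_tanTriv (n := n) (continuousAt_id (x := X.proj))] with z hz
  exact coord_constSection X hz

@[simp] theorem coord_std (x : M) : coord x (std x) = ContinuousLinearMap.id ℝ (Eucl n) := by
  have h : x ∈ (tanTriv (n := n) x).baseSet := FiberBundle.mem_baseSet_trivializationAt' _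
  rw [← coe_coordEquiv x (std x) h]
  refine ContinuousLinearMap.ext fun v => ?_
  simp only [coordEquiv, std, iso_mk]
  exact ((tanTriv x).continuousLinearEquivAt ℝ x h).apply_symm_apply v

theorem coord_mk_trans_std (x : M) (g : GLn n) :
    coord x (mk x (g.trans (std x : FrameBundle n M).iso)) = (g : Eucl n →L[ℝ] Eucl n) := by
  refine Eq.trans ?_ (congrArg (fun A => A.comp (g : Eucl n →L[ℝ] Eucl n)) (coord_std x))
  simp only [coord, iso_mk]
  rfl

/-- On `ℝⁿ` the matrix of a frame is the frame itself. -/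
theorem coord_eucl (w : Eucl n) (X : FrameBundle n (Eucl n)) :
    coord w X = (X.iso : Eucl n →L[ℝ] TangentSpace (𝓡 n) X.proj) := by
  rw [coord, TangentBundle.continuousLinearMapAt_model_space]
  rfl

/-- The action is transitive on fibres, with `g = X⁻¹ ∘ Y`. -/
theorem exists_act_eq {X Y : FrameBundle n M} (h : X.proj = Y.proj) : ∃ g : GLn n, X.act g = Y := by
  obtain ⟨x, L, rfl⟩ : ∃ x L, X = mk x L := ⟨_, _, (mk_proj_iso X).symm⟩
  obtain ⟨y, L', rfl⟩ : ∃ y L, Y = mk y L := ⟨_, _, (mk_proj_iso Y).symm⟩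
  obtain rfl : x = y := h
  refine ⟨L'.trans L.symm, ext_mk rfl fun v => ?_⟩
  rw [iso_mk]
  exact L.apply_symm_apply (L' v)

end FrameBundle

/-! ### The base map of a local isomorphism -/

namespace LocalIso

open FrameBundle

theorem mem_source_iff (Θ : LocalIso n M N) {X Y : FrameBundle n M} (h : X.proj = Y.proj) :
    X ∈ Θ.source ↔ Y ∈ Θ.source := by
  refine ⟨fun hX => ?_, fun hY => ?_⟩
  · obtain ⟨g, rfl⟩ := exists_act_eq h
    exact Θ.act_mem_source X hX g
  · obtain ⟨g, rfl⟩ := exists_act_eq h.symm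
    exact Θ.act_mem_source Y hY g

theorem std_mem_source_iff (Θ : LocalIso n M N) {X : FrameBundle n M} :
    std X.proj ∈ Θ.source ↔ X ∈ Θ.source :=
  Θ.mem_source_iff rfl

/-- The linear isomorphism `T_x M → T_y N`, `y = θ x`, by which `Θ` acts on the frames at `x`. -/
def fiber (Θ : LocalIso n M N) (x : M) :
    TangentSpace (𝓡 n) x ≃L[ℝ] TangentSpace (𝓡 n) (Θ.base x) :=
  ((std x : FrameBundle n M).iso.symm : TangentSpace (𝓡 n) x ≃L[ℝ] Eucl n).trans
    (Θ.map (std x)).iso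

/-- Every frame is `std · g` for some `g`, so by equivariance the value at `std` determines `Θ` on
the whole fibre, as left composition with one linear isomorphism. -/
theorem map_eq (Θ : LocalIso n M N) {X : FrameBundle n M} (hX : X ∈ Θ.source) :
    Θ.map X = FrameBundle.mk (Θ.base X.proj) (X.iso.trans (Θ.fiber X.proj)) := by
  have hs : std X.proj ∈ Θ.source := Θ.std_mem_source_iff.2 hX
  obtain ⟨g, hg⟩ := exists_act_eq (X := std X.proj) (Y := X) rfl
  have hi : X.iso = g.trans (std X.proj : FrameBundle n M).iso := by
    obtain ⟨x, L, rfl⟩ : ∃ x L, X = FrameBundle.mk x L := ⟨_, _, (mk_proj_iso X).symm⟩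
    have h2 : (std x : FrameBundle n M).act g = FrameBundle.mk x L := hg
    have h3 := congrArg Subtype.val h2
    have h4 := TotalSpace.mk_injective _ h3
    rw [iso_mk]
    exact ContinuousLinearEquiv.coe_injective h4.symm
  have h1 : Θ.map X = (Θ.map (std X.proj)).act g := by
    conv_lhs => rw [← hg]
    exact Θ.map_act _ hs g
  rw [h1, act]
  refine ext_mk rfl fun v => ?_
  rw [hi]
  refine congrArg (Θ.map (std X.proj)).iso ?_
  exact ((std X.proj : FrameBundle n M).iso.symm_apply_apply (g v)).symm

theorem proj_map (Θ : LocalIso n M N) {X : FrameBundle n M} (hX : X ∈ Θ.source) :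
    (Θ.map X).proj = Θ.base X.proj := by
  rw [Θ.map_eq hX, proj_mk]

theorem contMDiffAt_map (Θ : LocalIso n M N) {X : FrameBundle n M} (hX : X ∈ Θ.source) :
    ContMDiffAt (FModel n) (FModel n) ∞ Θ.map X :=
  Θ.contMDiffOn_toFun.contMDiffAt (Θ.open_source.mem_nhds hX)

theorem eventually_constSection_mem (Θ : LocalIso n M N) {X : FrameBundle n M}
    (hX : X ∈ Θ.source) : ∀ᶠ z in 𝓝 X.proj, constSection X z ∈ Θ.source := by
  refine (contMDiffAt_constSection X).continuousAt.preimage_mem_nhds ?_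
  rw [constSection_self]
  exact Θ.open_source.mem_nhds hX

/-- `base` is defined through `std`, which need not be continuous. Replacing `std` by a smooth
section makes smoothness and derivatives of `base` accessible. -/
theorem base_eventuallyEq (Θ : LocalIso n M N) {X : FrameBundle n M} (hX : X ∈ Θ.source) :
    Θ.base =ᶠ[𝓝 X.proj] fun z => (Θ.map (constSection X z)).proj := by
  filter_upwards [Θ.eventually_constSection_mem hX] with z hz
  rw [Θ.proj_map hz, proj_constSection]

theorem contMDiffAt_base (Θ : LocalIso n M N) {x : M} (hx : std x ∈ Θ.source) :
    ContMDiffAt (𝓡 n) (𝓡 n) ∞ Θ.base x := by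
  refine ContMDiffAt.congr_of_eventuallyEq ?_ (Θ.base_eventuallyEq hx)
  have h : constSection (std x) x = (std x : FrameBundle n M) := constSection_self (std x)
  have h1 : ContMDiffAt (FModel n) (FModel n) ∞ Θ.map (constSection (std x) x) := by
    rw [h]
    exact Θ.contMDiffAt_map hx
  exact contMDiff_proj.contMDiffAt.comp x
    (h1.comp x (contMDiffAt_constSection (std x : FrameBundle n M)))

theorem isOpen_baseSource (Θ : LocalIso n M N) : IsOpen {x : M | std x ∈ Θ.source} := by
  rw [isOpen_iff_mem_nhds]
  intro x hx
  filter_upwards [Θ.eventually_constSection_mem (X := std x) hx] with z hz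
  exact (Θ.mem_source_iff (by simp)).1 hz

theorem symm_map_map (Θ : LocalIso n M N) {X : FrameBundle n M} (hX : X ∈ Θ.source) :
    Θ.symm.map (Θ.map X) = X :=
  Θ.left_inv' hX

theorem map_mem_target (Θ : LocalIso n M N) {X : FrameBundle n M} (hX : X ∈ Θ.source) :
    Θ.map X ∈ Θ.target :=
  Θ.map_source' hX

theorem base_mem_target (Θ : LocalIso n M N) {x : M} (hx : std x ∈ Θ.source) :
    std (Θ.base x) ∈ Θ.target :=
  Θ.symm.std_mem_source_iff.2 (Θ.map_mem_target hx)

theorem symm_base_base (Θ : LocalIso n M N) {x : M} (hx : std x ∈ Θ.source) :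
    Θ.symm.base (Θ.base x) = x := by
  have h := Θ.symm.proj_map (X := Θ.map (std x)) (Θ.map_mem_target hx)
  rw [Θ.symm_map_map hx] at h
  exact h.symm

theorem mem_trans_source (Θ : LocalIso n M N) (Ξ : LocalIso n N K) {X : FrameBundle n M} :
    X ∈ (Θ.trans Ξ).source ↔ X ∈ Θ.source ∧ Θ.map X ∈ Ξ.source := Iff.rfl

theorem trans_base (Θ : LocalIso n M N) (Ξ : LocalIso n N K) {x : M}
    (hx : std x ∈ (Θ.trans Ξ).source) : (Θ.trans Ξ).base x = Ξ.base (Θ.base x) :=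
  Ξ.proj_map (X := Θ.map (std x)) ((Θ.mem_trans_source Ξ).1 hx).2

/-- The base map of a local isomorphism as a local diffeomorphism. -/
def baseHomeo (Θ : LocalIso n M N) : OpenPartialHomeomorph M N where
  toFun := Θ.base
  invFun := Θ.symm.base
  source := {x | (std x : FrameBundle n M) ∈ Θ.source}
  target := {y | (std y : FrameBundle n N) ∈ Θ.target}
  map_source' _ hx := Θ.base_mem_target hx
  map_target' _ hy := Θ.symm.base_mem_target hy
  left_inv' _ hx := Θ.symm_base_base hx
  right_inv' _ hy := Θ.symm.symm_base_base hy
  open_source := Θ.isOpen_baseSource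
  open_target := Θ.symm.isOpen_baseSource
  continuousOn_toFun _ hx := (Θ.contMDiffAt_base hx).continuousAt.continuousWithinAt
  continuousOn_invFun _ hy := (Θ.symm.contMDiffAt_base hy).continuousAt.continuousWithinAt

theorem contMDiffOn_baseHomeo (Θ : LocalIso n M N) :
    ContMDiffOn (𝓡 n) (𝓡 n) ∞ Θ.baseHomeo Θ.baseHomeo.source :=
  fun _ hx => (Θ.contMDiffAt_base hx).contMDiffWithinAt

theorem contMDiffOn_baseHomeo_symm (Θ : LocalIso n M N) :
    ContMDiffOn (𝓡 n) (𝓡 n) ∞ Θ.baseHomeo.symm Θ.baseHomeo.target :=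
  fun _ hx => (Θ.symm.contMDiffAt_base hx).contMDiffWithinAt

theorem fiber_trans (Θ : LocalIso n M N) (Ξ : LocalIso n N K) {x : M}
    (hx : std x ∈ (Θ.trans Ξ).source) (v : TangentSpace (𝓡 n) x) :
    ((Θ.trans Ξ).fiber x v : Eucl n) = Ξ.fiber (Θ.base x) (Θ.fiber x v) := by
  have h := Ξ.map_eq (X := Θ.map (std x)) ((Θ.mem_trans_source Ξ).1 hx).2
  have h' : (Θ.trans Ξ).map (std x) = FrameBundle.mk (Ξ.base (Θ.base x))
    ((Θ.map (std x)).iso.trans (Ξ.fiber (Θ.base x))) := h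
  have key : ∀ {Y Z : FrameBundle n K}, Y = Z → ∀ w, (Y.iso w : Eucl n) = Z.iso w := by
    rintro Y _ rfl w
    rfl
  refine (key h' ((std x : FrameBundle n M).iso.symm v)).trans ?_
  rw [iso_mk]
  rfl

end LocalIso

/-! ### The two projections to the groupoid of `1`-jets -/

section Projections

open FrameBundle

/-- The action of a jet on frames, as a `1`-jet on the base. -/
def frameJet (j : OneJet (FModel n) (FrameBundle n M)) : OneJet (𝓡 n) M :=
  ⟨j.src.proj, j.tgt.proj, (j.src.iso.symm.trans j.tgt.iso :
    TangentSpace (𝓡 n) j.src.proj ≃L[ℝ] TangentSpace (𝓡 n) j.tgt.proj)⟩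

/-- The `1`-jet induced by a jet on the base. -/
def baseJet (j : OneJet (FModel n) (FrameBundle n M)) : OneJet (𝓡 n) M :=
  ⟨j.src.proj, j.tgt.proj, (mfderiv (FModel n) (𝓡 n) proj j.tgt).comp
    (j.lin.comp (mfderiv (𝓡 n) (FModel n) (constSection j.src) j.src.proj :
      Eucl n →L[ℝ] (Eucl n × (Eucl n →L[ℝ] Eucl n))) :
      Eucl n →L[ℝ] (Eucl n × (Eucl n →L[ℝ] Eucl n)))⟩

theorem frameJet_oneJet (Θ : LocalIso n M M) {X : FrameBundle n M} (hX : X ∈ Θ.source) :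
    frameJet (oneJet (FModel n) Θ.map X) =
      ⟨X.proj, Θ.base X.proj, (Θ.fiber X.proj :
        TangentSpace (𝓡 n) X.proj →L[ℝ] TangentSpace (𝓡 n) (Θ.base X.proj))⟩ := by
  refine OneJet.ext_model rfl (Θ.proj_map hX) (ContinuousLinearMap.ext fun v => ?_)
  change ((Θ.map X).iso (X.iso.symm v) : Eucl n) = Θ.fiber X.proj v
  rw [Θ.map_eq hX, iso_mk]
  exact congrArg (Θ.fiber X.proj) (X.iso.apply_symm_apply v)

/-- Chain rule for `π ∘ Θ ∘ s`, with `s` the constant section through `X`. The result does not see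
which frame over the point was used, which lets `baseJet` descend to orbits. -/
theorem baseJet_oneJet (Θ : LocalIso n M M) {X : FrameBundle n M} (hX : X ∈ Θ.source) :
    baseJet (oneJet (FModel n) Θ.map X) = oneJet (𝓡 n) Θ.base X.proj := by
  refine OneJet.ext_model rfl (Θ.proj_map hX) ?_
  have hs : MDifferentiableAt (𝓡 n) (FModel n) (constSection X) X.proj :=
    (contMDiffAt_constSection X).mdifferentiableAt (by simp)
  have hm : MDifferentiableAt (FModel n) (FModel n) Θ.map (constSection X X.proj) := by
    rw [constSection_self]
    exact (Θ.contMDiffAt_map hX).mdifferentiableAt (by simp)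
  have hp : MDifferentiableAt (FModel n) (𝓡 n) (proj : FrameBundle n M → M)
      (Θ.map (constSection X X.proj)) :=
    contMDiff_proj.mdifferentiableAt (by simp)
  have h : mfderiv (𝓡 n) (𝓡 n) Θ.base X.proj = mfderiv (𝓡 n) (𝓡 n)
      (proj ∘ Θ.map ∘ constSection X) X.proj :=
    (Θ.base_eventuallyEq hX).mfderiv_eq
  change _ = (mfderiv (𝓡 n) (𝓡 n) Θ.base X.proj : Eucl n →L[ℝ] Eucl n)
  rw [h, mfderiv_comp (I' := FModel n) X.proj hp (hm.comp X.proj hs),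
    mfderiv_comp (I' := FModel n) X.proj hm hs]
  -- The chain rule evaluates derivatives at `constSection X X.proj`, which equals `X` only
  -- propositionally; the statement in the model spaces permits the substitution.
  have key : ∀ Y : FrameBundle n M, Y = X →
      ∀ D : Eucl n →L[ℝ] (Eucl n × (Eucl n →L[ℝ] Eucl n)),
      ((mfderiv (FModel n) (𝓡 n) proj (Θ.map X) :
          (Eucl n × (Eucl n →L[ℝ] Eucl n)) →L[ℝ] Eucl n).comp
        ((mfderiv (FModel n) (FModel n) Θ.map X : (Eucl n × (Eucl n →L[ℝ] Eucl n)) →L[ℝ]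
          (Eucl n × (Eucl n →L[ℝ] Eucl n))).comp D)) =
      ((mfderiv (FModel n) (𝓡 n) proj (Θ.map Y) :
          (Eucl n × (Eucl n →L[ℝ] Eucl n)) →L[ℝ] Eucl n).comp
        ((mfderiv (FModel n) (FModel n) Θ.map Y : (Eucl n × (Eucl n →L[ℝ] Eucl n)) →L[ℝ]
          (Eucl n × (Eucl n →L[ℝ] Eucl n))).comp D)) := by
    rintro _ rfl D
    rfl
  exact key _ (constSection_self X) _

namespace NonholonomicGroupoid

/-- The action on frames of an element of the second-order non-holonomic groupoid. -/
def frame : NonholonomicGroupoid n M → OneJet (𝓡 n) M :=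
  Quot.lift (fun j => frameJet j.1) (by
    rintro j j' ⟨Θ, X, g, hX, h, h'⟩
    simp only [h, h']
    rw [frameJet_oneJet Θ hX, frameJet_oneJet Θ (Θ.act_mem_source X hX g)]
    rfl)

/-- The `1`-jet induced on the base by an element of the second-order non-holonomic groupoid. -/
def baseMap : NonholonomicGroupoid n M → OneJet (𝓡 n) M :=
  Quot.lift (fun j => baseJet j.1) (by
    rintro j j' ⟨Θ, X, g, hX, h, h'⟩
    simp only [h, h']
    rw [baseJet_oneJet Θ hX, baseJet_oneJet Θ (Θ.act_mem_source X hX g)]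
    rfl)

theorem frame_jet (Θ : LocalIso n M M) (x : M) (hx : std x ∈ Θ.source) :
    (Θ.jet x hx).frame = ⟨x, Θ.base x, (Θ.fiber x :
      TangentSpace (𝓡 n) x →L[ℝ] TangentSpace (𝓡 n) (Θ.base x))⟩ :=
  frameJet_oneJet Θ hx

theorem baseMap_jet (Θ : LocalIso n M M) (x : M) (hx : std x ∈ Θ.source) :
    (Θ.jet x hx).baseMap = oneJet (𝓡 n) Θ.base x :=
  baseJet_oneJet Θ hx

/-- Every element of the second-order non-holonomic groupoid is of the form `j¹_{x,y} Θ`. -/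
theorem exists_jet_eq (a : NonholonomicGroupoid n M) :
    ∃ (Θ : LocalIso n M M) (x : M) (hx : std x ∈ Θ.source), a = Θ.jet x hx := by
  obtain ⟨⟨j, Θ, X, hX, rfl⟩, rfl⟩ := Quot.exists_rep a
  have hs : std X.proj ∈ Θ.source := Θ.std_mem_source_iff.2 hX
  obtain ⟨g, hg⟩ := exists_act_eq (X := X) (Y := std X.proj) rfl
  exact ⟨Θ, X.proj, hs, Quot.sound ⟨Θ, X, g, hX, rfl, by rw [hg]⟩⟩

end NonholonomicGroupoid

end Projections

/-! ### Sections of the groupoid of `1`-jets acting on frames -/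

namespace PiSection

open FrameBundle

/-- `P (x, x)` is an idempotent isomorphism, hence the identity. -/
theorem toFun_self (P : PiSection n M) (x : M) (v : TangentSpace (𝓡 n) x) : P.toFun x x v = v :=
  (P.toFun x x).injective (DFunLike.congr_fun (P.comp x x x) v)

theorem toFun_toFun (P : PiSection n M) (x y z : M) (v : TangentSpace (𝓡 n) x) :
    P.toFun y z (P.toFun x y v) = P.toFun x z v :=
  DFunLike.congr_fun (P.comp x y z) v

theorem toFun_toFun_of_eq (P : PiSection n M) {x y z : M} (h : z = x) (v : TangentSpace (𝓡 n) x) :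
    (P.toFun y z (P.toFun x y v) : Eucl n) = v := by
  subst h
  rw [P.toFun_toFun, P.toFun_self]

/-- The frame `P (z, y) · X` at `y`, for a frame `X` at `z`. -/
def move (P : PiSection n M) (q : FrameBundle n M × M) : FrameBundle n M :=
  FrameBundle.mk q.2 (q.1.iso.trans (P.toFun q.1.proj q.2))

@[simp] theorem proj_move (P : PiSection n M) (q : FrameBundle n M × M) :
    (P.move q).proj = q.2 := rfl

/-- The matrix of the moved frame is the product of the matrices of `P (z, y)` and of `X`, both
smooth. All smoothness of maps built from `P` is drawn from here. -/
theorem contMDiff_move (P : PiSection n M) :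
    ContMDiff ((FModel n).prod (𝓡 n)) (FModel n) ∞ P.move := by
  rintro ⟨X₀, y₀⟩
  rw [contMDiffAt_frameBundle_iff]
  refine ⟨contMDiffAt_snd, ?_⟩
  have h1 : ContMDiffAt ((FModel n).prod (𝓡 n)) ((𝓡 n).prod (𝓡 n)) ∞
      (fun q : FrameBundle n M × M => (q.1.proj, q.2)) (X₀, y₀) :=
    ((FrameBundle.contMDiff_proj.comp contMDiff_fst).prodMk contMDiff_snd).contMDiffAt
  have h2 := (P.smooth (X₀.proj, y₀)).2.2
  have h3 := ContMDiffAt.comp (X₀, y₀) h2 h1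
  have h4 : ContMDiffAt ((FModel n).prod (𝓡 n)) 𝓘(ℝ, Eucl n →L[ℝ] Eucl n) ∞
      (fun q : FrameBundle n M × M => coord X₀.proj q.1) (X₀, y₀) :=
    ContMDiffAt.comp (X₀, y₀) (contMDiffAt_frameBundle_iff.1 (contMDiffAt_id (x := X₀))).2 contMDiffAt_fst
  refine (h3.clm_comp h4).congr_of_eventuallyEq ?_
  have h5 : ContMDiffAt ((FModel n).prod (𝓡 n)) (𝓡 n) ∞
      (fun q : FrameBundle n M × M => q.1.proj) (X₀, y₀) :=
    (FrameBundle.contMDiff_proj.comp contMDiff_fst).contMDiffAt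
  filter_upwards [eventually_mem_tanTriv (n := n) h5.continuousAt] with q hq
  refine (coord_mk_trans (L := q.1.iso) hq).trans ?_
  rw [mk_proj_iso]
  rfl

/-- The isomorphism `T_x M → ℝⁿ` given by the parallelism `P` and the standard frame at `a`. -/
def toModel (P : PiSection n M) (a x : M) : TangentSpace (𝓡 n) x ≃L[ℝ] Eucl n :=
  (P.toFun x a).trans (std a : FrameBundle n M).iso.symm

/-- In the trivialization of `TM` given by `toModel`, every `P (x, y)` becomes the identity of `ℝⁿ`.
-/
theorem toModel_toFun (P : PiSection n M) (a x y : M) (v : TangentSpace (𝓡 n) x) :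
    P.toModel a y (P.toFun x y v) = P.toModel a x v :=
  congrArg (std a : FrameBundle n M).iso.symm (P.toFun_toFun x y a v)

/-- The frame at `e x` which expresses the frame `X` at `x` in the parallelism `P`. -/
def frameMap (P : PiSection n M) (a : M) (e : M → Eucl n) (X : FrameBundle n M) :
    FrameBundle n (Eucl n) :=
  FrameBundle.mk (e X.proj) (X.iso.trans (P.toModel a X.proj) : Eucl n ≃L[ℝ] Eucl n)

/-- The inverse of `frameMap`. -/
def frameMapInv (P : PiSection n M) (a : M) (e : Eucl n → M) (Y : FrameBundle n (Eucl n)) :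
    FrameBundle n M :=
  FrameBundle.mk (e Y.proj) ((Y.iso : Eucl n ≃L[ℝ] Eucl n).trans (P.toModel a (e Y.proj)).symm)

theorem iso_frameMap (P : PiSection n M) (a : M) (e : M → Eucl n) (X : FrameBundle n M)
    (v : Eucl n) : ((P.frameMap a e X).iso v : Eucl n) = P.toModel a X.proj (X.iso v) :=
  DFunLike.congr_fun (iso_mk (e X.proj) (X.iso.trans (P.toModel a X.proj))) v

theorem iso_frameMapInv (P : PiSection n M) (a : M) (e : Eucl n → M) (Y : FrameBundle n (Eucl n))
    (v : Eucl n) :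
    (P.frameMapInv a e Y).iso v = (P.toModel a (e Y.proj)).symm (Y.iso v : Eucl n) := by
  rw [frameMapInv, iso_mk]
  rfl

/-- On `ℝⁿ` the matrix of a frame is the frame itself; here it is the matrix at `a` of `P (z, a) ·
X`, so `contMDiff_move` applies. -/
theorem contMDiffAt_frameMap (P : PiSection n M) (a : M) {e : M → Eucl n} {X : FrameBundle n M}
    (he : ContMDiffAt (𝓡 n) (𝓡 n) ∞ e X.proj) :
    ContMDiffAt (FModel n) (FModel n) ∞ (P.frameMap a e) X := by
  rw [contMDiffAt_frameBundle_iff]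
  refine ⟨?_, ?_⟩
  · change ContMDiffAt (FModel n) (𝓡 n) ∞ (e ∘ proj) X
    exact ContMDiffAt.comp X he FrameBundle.contMDiff_proj.contMDiffAt
  have h1 : ContMDiffAt (FModel n) (FModel n) ∞ (fun Z => P.move (Z, a)) X :=
    P.contMDiff_move.contMDiffAt.comp X (contMDiffAt_id.prodMk contMDiffAt_const)
  refine (contMDiffAt_frameBundle_iff.1 h1).2.congr_of_eventuallyEq (Filter.Eventually.of_forall fun Z => ?_)
  have h2 := coe_coordEquiv a (P.move (Z, a)) (FiberBundle.mem_baseSet_trivializationAt' a)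
  refine ContinuousLinearMap.ext fun v => (DFunLike.congr_fun (coord_eucl _ _) v).trans
    ((P.iso_frameMap a e Z v).trans (Eq.trans ?_ (DFunLike.congr_fun h2 v)))
  simp only [coordEquiv, move, iso_mk, toModel, std]
  rfl

/-- Since `P (z, a)⁻¹ = P (a, z)`, the inverse is again an action of `P`, now on a frame at `a`; its
smoothness then needs no inversion of linear maps. -/
theorem frameMapInv_eq (P : PiSection n M) (a : M) (e : Eucl n → M) (Y : FrameBundle n (Eucl n)) :
    P.frameMapInv a e Y = P.move (FrameBundle.mk a
      ((Y.iso : Eucl n ≃L[ℝ] Eucl n).trans (std a : FrameBundle n M).iso), e Y.proj) := by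
  refine ext_mk rfl fun v => ?_
  rw [iso_mk]
  refine ((P.toModel a (e Y.proj)).symm_apply_eq).2 ?_
  refine Eq.symm (((std a : FrameBundle n M).iso.symm_apply_eq).2 ?_)
  exact P.toFun_toFun_of_eq rfl _

theorem contMDiffAt_frameMapInv (P : PiSection n M) (a : M) {e : Eucl n → M}
    {Y : FrameBundle n (Eucl n)} (he : ContMDiffAt (𝓡 n) (𝓡 n) ∞ e Y.proj) :
    ContMDiffAt (FModel n) (FModel n) ∞ (P.frameMapInv a e) Y := by
  rw [show P.frameMapInv a e = _ from funext (P.frameMapInv_eq a e)]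
  refine P.contMDiff_move.contMDiffAt.comp Y (ContMDiffAt.prodMk ?_
    (ContMDiffAt.comp Y he FrameBundle.contMDiff_proj.contMDiffAt))
  rw [contMDiffAt_frameBundle_iff]
  refine ⟨contMDiffAt_const, ?_⟩
  refine (contMDiffAt_frameBundle_iff.1 (contMDiffAt_id (x := Y))).2.congr_of_eventuallyEq
    (Filter.Eventually.of_forall fun Z => ?_)
  exact (coord_mk_trans_std a _).trans (coord_eucl _ Z).symm

/-- The local isomorphism `FU → F(e U)` given by the parallelism `P` and a chart `e` on `U`. -/
def localIso (P : PiSection n M) (a : M) (e : OpenPartialHomeomorph M (Eucl n))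
    (he : ContMDiffOn (𝓡 n) (𝓡 n) ∞ e e.source)
    (he' : ContMDiffOn (𝓡 n) (𝓡 n) ∞ e.symm e.target) : LocalIso n M (Eucl n) :=
  have h1 : ContMDiffOn (FModel n) (FModel n) ∞ (P.frameMap a e) (proj ⁻¹' e.source) :=
    fun _ hX => (P.contMDiffAt_frameMap a
      (he.contMDiffAt (e.open_source.mem_nhds hX))).contMDiffWithinAt
  have h2 : ContMDiffOn (FModel n) (FModel n) ∞ (P.frameMapInv a e.symm) (proj ⁻¹' e.target) :=
    fun _ hX => (P.contMDiffAt_frameMapInv a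
      (he'.contMDiffAt (e.open_target.mem_nhds hX))).contMDiffWithinAt
  { toFun := P.frameMap a e
    invFun := P.frameMapInv a e.symm
    source := proj ⁻¹' e.source
    target := proj ⁻¹' e.target
    map_source' := fun _ hX => e.map_source hX
    map_target' := fun _ hY => e.map_target hY
    left_inv' := fun X hX => by
      have hX' : X.proj ∈ e.source := hX
      refine Eq.trans (ext_mk (e.left_inv hX') fun v => ?_) (mk_proj_iso X)
      change ((P.toModel a (e.symm (e X.proj))).symm ((P.frameMap a e X).iso v : Eucl n) : Eucl n) =
        X.iso v
      rw [iso_frameMap]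
      have key : ∀ z : M, z = X.proj → ((P.toModel a z).symm (P.toModel a X.proj (X.iso v)) :
          Eucl n) = X.iso v := by
        rintro _ rfl
        exact (P.toModel a X.proj).symm_apply_apply _
      exact key _ (e.left_inv hX')
    right_inv' := fun Y hY => by
      have hY' : Y.proj ∈ e.target := hY
      refine Eq.trans (ext_mk (e.right_inv hY') fun v => ?_) (mk_proj_iso Y)
      change P.toModel a (e.symm Y.proj) ((P.frameMapInv a e.symm Y).iso v) = (Y.iso v : Eucl n)
      rw [iso_frameMapInv]
      exact (P.toModel a (e.symm Y.proj)).apply_symm_apply _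
    open_source := e.open_source.preimage FrameBundle.contMDiff_proj.continuous
    open_target := e.open_target.preimage FrameBundle.contMDiff_proj.continuous
    continuousOn_toFun := h1.continuousOn
    continuousOn_invFun := h2.continuousOn
    contMDiffOn_toFun := h1
    contMDiffOn_invFun := h2
    act_mem_source := fun _ hX _ => hX
    map_act := fun X _ g => by
      refine ext_mk rfl fun v => ?_
      change P.toModel a X.proj ((X.act g).iso v) = ((P.frameMap a e X).iso (g v) : Eucl n)
      rw [iso_frameMap, act, iso_mk]
      rfl }

/-- The `1`-jet at `X` of `X ↦ P (z, ψ z) · X`, `z = π X`, in terms of the `1`-jet of `ψ`. -/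
def moveJet (P : PiSection n M) (X : FrameBundle n M) (j : OneJet (𝓡 n) M) :
    OneJet (FModel n) (FrameBundle n M) :=
  ⟨X, P.move (X, j.tgt), (mfderiv ((FModel n).prod (𝓡 n)) (FModel n) P.move (X, j.tgt) :
      ((Eucl n × (Eucl n →L[ℝ] Eucl n)) × Eucl n) →L[ℝ] (Eucl n × (Eucl n →L[ℝ] Eucl n))).comp
    ((ContinuousLinearMap.id ℝ (Eucl n × (Eucl n →L[ℝ] Eucl n))).prod
      ((j.lin : Eucl n →L[ℝ] Eucl n).comp (mfderiv (FModel n) (𝓡 n) proj X :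
        (Eucl n × (Eucl n →L[ℝ] Eucl n)) →L[ℝ] Eucl n)))⟩

/-- Chain rule for `X ↦ (X, ψ (π X))` followed by `move`. The right-hand side sees `ψ` only through
its `1`-jet, so prolongations over different `ψ` with the same jet coincide. -/
theorem oneJet_eq_moveJet (P : PiSection n M) {ψ : M → M} {X : FrameBundle n M}
    {F : FrameBundle n M → FrameBundle n M} (hF : F =ᶠ[𝓝 X] fun Z => P.move (Z, ψ Z.proj))
    (hψ : MDifferentiableAt (𝓡 n) (𝓡 n) ψ X.proj) :
    oneJet (FModel n) F X = P.moveJet X (oneJet (𝓡 n) ψ X.proj) := by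
  refine OneJet.ext_model rfl hF.eq_of_nhds ?_
  have hp : MDifferentiableAt (FModel n) (𝓡 n) (proj : FrameBundle n M → M) X :=
    FrameBundle.contMDiff_proj.mdifferentiableAt (by simp)
  have hc : MDifferentiableAt (FModel n) (𝓡 n) (ψ ∘ proj) X := hψ.comp X hp
  have hm : MDifferentiableAt ((FModel n).prod (𝓡 n)) (FModel n) P.move (X, ψ X.proj) :=
    P.contMDiff_move.mdifferentiableAt (by simp)
  have h1 : mfderiv (FModel n) (FModel n) F X = mfderiv (FModel n) (FModel n)
      (P.move ∘ fun Z => (id Z, (ψ ∘ proj) Z)) X := hF.mfderiv_eq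
  refine Eq.trans (show _ = _ from h1) ?_
  rw [mfderiv_comp (I' := (FModel n).prod (𝓡 n)) X hm (mdifferentiableAt_id.prodMk hc),
    mfderiv_prodMk mdifferentiableAt_id hc, mfderiv_comp (I' := 𝓡 n) X hψ hp, mfderiv_id]
  rfl

end PiSection

/-! ### Derivatives in the model space -/

section ModelDeriv

variable {n : ℕ} {M : Type*} [TopologicalSpace M] [ChartedSpace (Eucl n) M]
  {N : Type*} [TopologicalSpace N] [ChartedSpace (Eucl n) N]
  {K : Type*} [TopologicalSpace K] [ChartedSpace (Eucl n) K]

theorem OneJet.lin_eq_of_eq {j j' : OneJet (𝓡 n) M} (h : j = j') :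
    (j.lin : Eucl n →L[ℝ] Eucl n) = (j'.lin : Eucl n →L[ℝ] Eucl n) := by
  subst h
  rfl

variable (n) in
/-- The derivative of a map, between the model spaces. -/
def modelDeriv (f : M → N) (x : M) : Eucl n →L[ℝ] Eucl n := mfderiv (𝓡 n) (𝓡 n) f x

theorem modelDeriv_comp {f : M → N} {g : N → K} {x : M} {y : N} (h : f x = y)
    (hg : MDifferentiableAt (𝓡 n) (𝓡 n) g y) (hf : MDifferentiableAt (𝓡 n) (𝓡 n) f x) :
    modelDeriv n (g ∘ f) x = (modelDeriv n g y).comp (modelDeriv n f x) := by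
  subst h
  exact mfderiv_comp x hg hf

@[simp] theorem translation_apply (v w : Eucl n) : translation v w = w + v := rfl

theorem mdifferentiableAt_translation (v w : Eucl n) :
    MDifferentiableAt (𝓡 n) (𝓡 n) (translation v) w :=
  (translation v).mdifferentiable (by simp) w

theorem modelDeriv_translation (v w : Eucl n) :
    modelDeriv n (translation v) w = ContinuousLinearMap.id ℝ (Eucl n) := by
  have h : modelDeriv n (translation v) w = fderiv ℝ (fun z : Eucl n => z + v) w := mfderiv_eq_fderiv
  rw [h, fderiv_add_const, fderiv_fun_id]

theorem modelDeriv_comp_translation_comp {f : M → Eucl n} {g : Eucl n → N} {x : M} {v w : Eucl n}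
    (h : f x + v = w) (hg : MDifferentiableAt (𝓡 n) (𝓡 n) g w)
    (hf : MDifferentiableAt (𝓡 n) (𝓡 n) f x) :
    modelDeriv n (g ∘ translation v ∘ f) x = (modelDeriv n g w).comp (modelDeriv n f x) := by
  rw [modelDeriv_comp (f := translation v ∘ f) (y := w) h hg ((mdifferentiableAt_translation v (f x)).comp x hf),
    modelDeriv_comp rfl (mdifferentiableAt_translation v (f x)) hf, modelDeriv_translation]
  rfl

theorem mdifferentiableAt_comp_translation_comp {f : M → Eucl n} {g : Eucl n → N} {x : M}
    {v w : Eucl n} (h : f x + v = w) (hg : MDifferentiableAt (𝓡 n) (𝓡 n) g w)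
    (hf : MDifferentiableAt (𝓡 n) (𝓡 n) f x) :
    MDifferentiableAt (𝓡 n) (𝓡 n) (g ∘ translation v ∘ f) x := by
  subst h
  exact MDifferentiableAt.comp x hg ((mdifferentiableAt_translation v (f x)).comp x hf)

end ModelDeriv

/-! ### Translations in adapted charts: integrable prolongations have the local form -/

open FrameBundle

theorem FrameBundle.lift_translation (v : Eucl n) (Y : FrameBundle n (Eucl n)) :
    lift (translation v) Y = mk (Y.proj + v) (Y.iso : Eucl n ≃L[ℝ] Eucl n) := by
  refine ext_mk rfl fun w => ?_
  exact DFunLike.congr_fun (modelDeriv_translation v Y.proj) (Y.iso w)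

namespace PiSection

/-- The local isomorphisms given by a parallelism and two charts intertwine the translations
with the action of the parallelism on frames. -/
theorem frameMapInv_lift_frameMap (P : PiSection n M) (a : M) (e : M → Eucl n) (f : Eucl n → M)
    (v : Eucl n) (X : FrameBundle n M) :
    P.frameMapInv a f (lift (translation v) (P.frameMap a e X)) =
      P.move (X, (f ∘ translation v ∘ e) X.proj) := by
  rw [lift_translation]
  refine ext_mk rfl fun w => ?_
  have h : ((FrameBundle.mk ((P.frameMap a e X).proj + v)
      ((P.frameMap a e X).iso : Eucl n ≃L[ℝ] Eucl n)).iso w : Eucl n) =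
      P.toModel a X.proj (X.iso w) := by
    exact (DFunLike.congr_fun (iso_mk ((P.frameMap a e X).proj + v)
      ((P.frameMap a e X).iso : Eucl n ≃L[ℝ] Eucl n)) w).trans (P.iso_frameMap a e X w)
  exact (congrArg (P.toModel a (f (e X.proj + v))).symm h).trans
    ((ContinuousLinearEquiv.symm_apply_eq _).2
      (P.toModel_toFun a X.proj (f (e X.proj + v)) (X.iso w)).symm)

/-- An integrable section is, around every pair of points, given by translations in two charts. -/
theorem IsIntegrable.exists_charts {Q : PiSection n M} (hQ : Q.IsIntegrable) (x₀ y₀ : M) :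
    ∃ e f : OpenPartialHomeomorph M (Eucl n),
      ContMDiffOn (𝓡 n) (𝓡 n) ∞ e e.source ∧ ContMDiffOn (𝓡 n) (𝓡 n) ∞ e.symm e.target ∧
      ContMDiffOn (𝓡 n) (𝓡 n) ∞ f f.source ∧ ContMDiffOn (𝓡 n) (𝓡 n) ∞ f.symm f.target ∧
      x₀ ∈ e.source ∧ y₀ ∈ f.source ∧ ∀ x ∈ e.source, ∀ y ∈ f.source,
        Q.jet x y = oneJet (𝓡 n) (f.symm ∘ translation (f y - e x) ∘ e) x := by
  obtain ⟨e, he, hx₀, hQe⟩ := hQ x₀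
  obtain ⟨f, hf, hy₀, hQf⟩ := hQ y₀
  have he1 : ContMDiffOn (𝓡 n) (𝓡 n) ∞ e e.source := contMDiffOn_of_mem_maximalAtlas he
  have he2 : ContMDiffOn (𝓡 n) (𝓡 n) ∞ e.symm e.target := contMDiffOn_symm_of_mem_maximalAtlas he
  have hf1 : ContMDiffOn (𝓡 n) (𝓡 n) ∞ f f.source := contMDiffOn_of_mem_maximalAtlas hf
  have hf2 : ContMDiffOn (𝓡 n) (𝓡 n) ∞ f.symm f.target := contMDiffOn_symm_of_mem_maximalAtlas hf
  have hed : e.MDifferentiable (𝓡 n) (𝓡 n) :=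
    ⟨he1.mdifferentiableOn (by simp), he2.mdifferentiableOn (by simp)⟩
  have hfd : f.MDifferentiable (𝓡 n) (𝓡 n) :=
    ⟨hf1.mdifferentiableOn (by simp), hf2.mdifferentiableOn (by simp)⟩
  -- `A = df ∘ Q (x₀, y₀) ∘ (de)⁻¹`: after replacing `e` by `A ∘ e`, the isomorphism `Q (x₀, y₀)` is
  -- the identity in the two charts.
  let A : Eucl n ≃L[ℝ] Eucl n :=
    ((hed.mfderiv hx₀).symm.trans (Q.toFun x₀ y₀)).trans (hfd.mfderiv hy₀)
  have hA : ContMDiff (𝓡 n) (𝓡 n) ∞ A := A.contDiff.contMDiff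
  have hA' : ContMDiff (𝓡 n) (𝓡 n) ∞ A.symm := A.symm.contDiff.contMDiff
  have hAe : ContMDiffOn (𝓡 n) (𝓡 n) ∞ (A ∘ e) e.source := hA.comp_contMDiffOn he1
  refine ⟨e.transHomeomorph A.toHomeomorph, f, hAe,
    he2.comp hA'.contMDiffOn (fun _ h => h), hf1, hf2, hx₀, hy₀, fun x hx y hy => ?_⟩
  change Q.jet x y = oneJet (𝓡 n) (f.symm ∘ translation (f y - A (e x)) ∘ (A ∘ e)) x
  have hv : ∀ a b : Eucl n, a + (b - a) = b := fun a b => by abel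
  refine OneJet.ext_model rfl ?_ ?_
  · change y = f.symm (A (e x) + (f y - A (e x)))
    rw [hv, f.left_inv hy]
  have h1 : modelDeriv n (f.symm ∘ translation (f y - A (e x)) ∘ (A ∘ e)) x =
      (modelDeriv n f.symm (f y)).comp (modelDeriv n (A ∘ e) x) :=
    modelDeriv_comp_translation_comp (hv _ _) (hfd.mdifferentiableAt_symm (f.map_source hy))
      ((hAe.contMDiffAt (e.open_source.mem_nhds hx)).mdifferentiableAt (by simp))
  have h2 : modelDeriv n (A ∘ e) x = (A : Eucl n →L[ℝ] Eucl n).comp (modelDeriv n e x) := by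
    rw [modelDeriv_comp rfl (hA.mdifferentiable (by simp) _) (hed.mdifferentiableAt hx)]
    congr 1
    have h : modelDeriv n A (e x) = fderiv ℝ A (e x) := mfderiv_eq_fderiv
    rw [h]
    exact A.fderiv
  have h3 : ((Q.jet x x₀).lin : Eucl n →L[ℝ] Eucl n) =
      (modelDeriv n e.symm (e x₀)).comp (modelDeriv n e x) :=
    (OneJet.lin_eq_of_eq (hQe x hx x₀ hx₀)).trans (modelDeriv_comp_translation_comp (hv _ _)
      (hed.mdifferentiableAt_symm (e.map_source hx₀)) (hed.mdifferentiableAt hx))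
  have h4 : ((Q.jet y₀ y).lin : Eucl n →L[ℝ] Eucl n) =
      (modelDeriv n f.symm (f y)).comp (modelDeriv n f y₀) :=
    (OneJet.lin_eq_of_eq (hQf y₀ hy₀ y hy)).trans (modelDeriv_comp_translation_comp (hv _ _)
      (hfd.mdifferentiableAt_symm (f.map_source hy)) (hfd.mdifferentiableAt hy₀))
  change _ = modelDeriv n (f.symm ∘ translation (f y - A (e x)) ∘ (A ∘ e)) x
  rw [h1, h2]
  refine ContinuousLinearMap.ext fun v => ?_
  change Q.toFun x y v = modelDeriv n f.symm (f y) (modelDeriv n f y₀ (Q.toFun x₀ y₀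
    (modelDeriv n e.symm (e x₀) (modelDeriv n e x v))))
  refine Eq.trans ?_ (DFunLike.congr_fun h4 _)
  -- Factor `Q (x, y) = Q (y₀, y) ∘ Q (x₀, y₀) ∘ Q (x, x₀)`: the outer factors are translations in
  -- the charts `f` and `e`, and the middle one is absorbed in `A`.
  refine Eq.trans ?_ (congrArg (fun w => Q.toFun y₀ y (Q.toFun x₀ y₀ w)) (DFunLike.congr_fun h3 v))
  change Q.toFun x y v = Q.toFun y₀ y (Q.toFun x₀ y₀ (Q.toFun x x₀ v))
  exact ((Q.toFun_toFun x₀ y₀ y _).trans (Q.toFun_toFun x x₀ y v)).symm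

end PiSection

/-- A second-order non-holonomic integrable prolongation is locally given by translations. -/
theorem NonholonomicSection.IsIntegrableProlongation.exists_localIso {R : NonholonomicSection n M}
    (hR : R.IsIntegrableProlongation) (x₀ y₀ : M) :
    ∃ (U V : Opens M) (U' V' : Opens (Eucl n)) (Φ Ψ : LocalIso n M (Eucl n)),
      x₀ ∈ U ∧ y₀ ∈ V ∧
      Φ.source = FrameBundle.proj ⁻¹' U ∧ Φ.target = FrameBundle.proj ⁻¹' U' ∧
      Ψ.source = FrameBundle.proj ⁻¹' V ∧ Ψ.target = FrameBundle.proj ⁻¹' V' ∧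
      ∀ x ∈ U, ∀ y ∈ V, ∃ hx, R.toFun x y =
        ((Φ.trans (.ofDiffeomorph (translation (Ψ.base y - Φ.base x)))).trans Ψ.symm).jet x hx := by
  obtain ⟨P, Q, hRPQ, hQ⟩ := hR
  obtain ⟨e, f, he1, he2, hf1, hf2, hx₀, hy₀, hQef⟩ := hQ.exists_charts x₀ y₀
  -- Both isomorphisms use the reference point `x₀`, also the one near `y₀`; the common `toModel` is
  -- what makes them intertwine translations with `P`.
  refine ⟨⟨e.source, e.open_source⟩, ⟨f.source, f.open_source⟩, ⟨e.target, e.open_target⟩,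
    ⟨f.target, f.open_target⟩, P.localIso x₀ e he1 he2, P.localIso x₀ f hf1 hf2, hx₀, hy₀,
    rfl, rfl, rfl, rfl, fun x hx y hy => ?_⟩
  have hv : e x + (f y - e x) = f y := by abel
  let Ξ : LocalIso n M M := ((P.localIso x₀ e he1 he2).trans
    (.ofDiffeomorph (translation (f y - e x)))).trans (P.localIso x₀ f hf1 hf2).symm
  have hs : std x ∈ Ξ.source := by
    refine ⟨⟨hx, mem_univ _⟩, ?_⟩
    change e x + (f y - e x) ∈ f.target
    rw [hv]
    exact f.map_source hy
  refine ⟨hs, ?_⟩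
  change R.toFun x y = Ξ.jet x hs
  obtain ⟨ψ, Θ, hψ, -, hxψ, hQψ, hΘs, hΘ, hx', hRΘ⟩ := hRPQ x y
  rw [hRΘ]
  refine congrArg NonholonomicGroupoid.mk (Subtype.ext ?_)
  change oneJet (FModel n) Θ.map (std x) = oneJet (FModel n) Ξ.map (std x)
  -- Both sides are actions of `P` over maps of `M`, so it suffices that these maps have the same
  -- `1`-jet at `x`, namely `Q (x, y)`.
  rw [P.oneJet_eq_moveJet (ψ := ψ) (Filter.eventually_of_mem (Θ.open_source.mem_nhds hx') hΘ)
      ((hψ.contMDiffAt (ψ.open_source.mem_nhds hxψ)).mdifferentiableAt (by simp)),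
    P.oneJet_eq_moveJet (X := std x) (F := Ξ.map) (ψ := f.symm ∘ translation (f y - e x) ∘ e)
      (Filter.Eventually.of_forall fun X => P.frameMapInv_lift_frameMap x₀ e f.symm _ X)
      (mdifferentiableAt_comp_translation_comp (x := x) hv
        ((hf2.contMDiffAt (f.open_target.mem_nhds (f.map_source hy))).mdifferentiableAt (by simp))
        ((he1.contMDiffAt (e.open_source.mem_nhds hx)).mdifferentiableAt (by simp)))]
  exact congrArg _ (hQψ.symm.trans (hQef x hx y hy))

/-! ### The sections of the groupoid of `1`-jets given by a section of the non-holonomic groupoid -/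

/-- A local homeomorphism to the model space which is smooth in both directions is a chart. -/
theorem mem_maximalAtlas_of_contMDiffOn {e : OpenPartialHomeomorph M (Eucl n)}
    (he : ContMDiffOn (𝓡 n) (𝓡 n) ∞ e e.source)
    (he' : ContMDiffOn (𝓡 n) (𝓡 n) ∞ e.symm e.target) :
    e ∈ IsManifold.maximalAtlas (𝓡 n) ∞ M := by
  have aux : ∀ f g : OpenPartialHomeomorph M (Eucl n),
      ContMDiffOn (𝓡 n) (𝓡 n) ∞ f f.source → ContMDiffOn (𝓡 n) (𝓡 n) ∞ f.symm f.target →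
      ContMDiffOn (𝓡 n) (𝓡 n) ∞ g g.source → ContMDiffOn (𝓡 n) (𝓡 n) ∞ g.symm g.target →
      f.symm ≫ₕ g ∈ contDiffGroupoid ∞ (𝓡 n) := by
    intro f g hf hf' hg hg'
    have h1 : ContMDiffOn (𝓡 n) (𝓡 n) ∞ (f.symm ≫ₕ g) (f.symm ≫ₕ g).source :=
      hg.comp (hf'.mono fun _ h => h.1) fun _ h => h.2
    have h2 : ContMDiffOn (𝓡 n) (𝓡 n) ∞ (f.symm ≫ₕ g).symm (f.symm ≫ₕ g).target :=
      hf.comp (hg'.mono fun _ h => h.1) fun _ h => h.2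
    refine mem_groupoid_of_pregroupoid.2 ⟨?_, ?_⟩
    · exact (contMDiffOn_iff_contDiffOn.1 h1).mono fun _ h => h.1
    · exact (contMDiffOn_iff_contDiffOn.1 h2).mono fun _ h => h.1
  intro e' he''
  have hm : e' ∈ IsManifold.maximalAtlas (𝓡 n) ∞ M :=
    IsManifold.subset_maximalAtlas he''
  exact ⟨aux e e' he he' (contMDiffOn_of_mem_maximalAtlas hm)
      (contMDiffOn_symm_of_mem_maximalAtlas hm),
    aux e' e (contMDiffOn_of_mem_maximalAtlas hm) (contMDiffOn_symm_of_mem_maximalAtlas hm) he he'⟩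

namespace FrameBundle

theorem coord_eq_inCoordinates_comp {x₀ y₀ x y : M}
    {A : TangentSpace (𝓡 n) x ≃L[ℝ] TangentSpace (𝓡 n) y} {X Y : FrameBundle n M}
    (hX : X.proj = x) (hY : Y.proj = y)
    (hA : ∀ v, (Y.iso v : Eucl n) = A (X.iso v : Eucl n))
    (hx : x ∈ (tanTriv (n := n) x₀).baseSet) :
    coord y₀ Y = (ContinuousLinearMap.inCoordinates (Eucl n) (TangentSpace (𝓡 n) : M → Type _)
      (Eucl n) (TangentSpace (𝓡 n) : M → Type _) x₀ x y₀ y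
      (A : TangentSpace (𝓡 n) x →L[ℝ] TangentSpace (𝓡 n) y)).comp (coord x₀ X) := by
  subst hX hY
  have h : Y = mk Y.proj (X.iso.trans A) := by
    conv_lhs => rw [← mk_proj_iso Y]
    exact ext_mk rfl hA
  conv_lhs => rw [h]
  rw [coord_mk_trans hx, mk_proj_iso]

/-- The translation vector varies with the parameter. It moves the base point by `v` and leaves the
matrix unchanged, hence the joint smoothness. -/
theorem contMDiffAt_lift_translation {v : S → Eucl n} {Z : S → FrameBundle n (Eucl n)}
    {s : S} (hv : ContMDiffAt J (𝓡 n) ∞ v s) (hZ : ContMDiffAt J (FModel n) ∞ Z s) :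
    ContMDiffAt J (FModel n) ∞ (fun t => lift (translation (v t)) (Z t)) s := by
  obtain ⟨h1, h2⟩ := contMDiffAt_frameBundle_iff.1 hZ
  refine contMDiffAt_frameBundle_iff.2 ⟨h1.add hv, ?_⟩
  refine h2.congr_of_eventuallyEq (Filter.Eventually.of_forall fun t => ?_)
  have h3 : lift (translation (v t)) (Z t) =
      mk ((Z t).proj + v t) ((Z t).iso : Eucl n ≃L[ℝ] Eucl n) := lift_translation _ _
  refine ContinuousLinearMap.ext fun w => ?_
  refine (DFunLike.congr_fun (coord_eucl _ _) w).trans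
    (Eq.trans ?_ (DFunLike.congr_fun (coord_eucl _ _) w).symm)
  have key : ∀ {Y Y' : FrameBundle n (Eucl n)}, Y = Y' → (Y.iso w : Eucl n) = Y'.iso w := by
    rintro Y _ rfl
    rfl
  exact (key h3).trans (DFunLike.congr_fun
    (iso_mk ((Z t).proj + v t) ((Z t).iso : Eucl n ≃L[ℝ] Eucl n)) w)

end FrameBundle

theorem inTangentCoordinates_congr {S : Type*} {f g : S → M} {ϕ : S → Eucl n →L[ℝ] Eucl n} {s t : S}
    {a b c d : M} {l : TangentSpace (𝓡 n) b →L[ℝ] TangentSpace (𝓡 n) d}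
    (ha : f s = a) (hb : f t = b) (hc : g s = c) (hd : g t = d)
    (hl : (l : Eucl n →L[ℝ] Eucl n) = ϕ t) :
    ContinuousLinearMap.inCoordinates (Eucl n) (TangentSpace (𝓡 n) : M → Type _)
      (Eucl n) (TangentSpace (𝓡 n) : M → Type _) a b c d l =
    inTangentCoordinates (𝓡 n) (𝓡 n) f g ϕ s t := by
  subst ha hb hc hd
  obtain rfl : l = ϕ t := hl
  rfl

/-! ### Base derivatives of local isomorphisms and the maps `Ψ⁻¹ ∘ Fτ_v ∘ Φ` -/

namespace LocalIso

theorem iso_map (Θ : LocalIso n M N) {X : FrameBundle n M} (hX : X ∈ Θ.source) {x : M}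
    (hx : X.proj = x) (v : Eucl n) : ((Θ.map X).iso v : Eucl n) = Θ.fiber x (X.iso v : Eucl n) := by
  subst hx
  have key : ∀ {Y Z : FrameBundle n N}, Y = Z → (Y.iso v : Eucl n) = Z.iso v := by
    rintro Y _ rfl
    rfl
  refine (key (Θ.map_eq hX)).trans ?_
  rw [iso_mk]
  rfl

/-- The derivative of the base map of a local isomorphism. -/
def baseDeriv (Θ : LocalIso n M N) (x : M) (hx : std x ∈ Θ.source) :
    TangentSpace (𝓡 n) x ≃L[ℝ] TangentSpace (𝓡 n) (Θ.base x) :=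
  OpenPartialHomeomorph.MDifferentiable.mfderiv (e := Θ.baseHomeo) (I := 𝓡 n) (I' := 𝓡 n)
    ⟨Θ.contMDiffOn_baseHomeo.mdifferentiableOn (by simp),
      Θ.contMDiffOn_baseHomeo_symm.mdifferentiableOn (by simp)⟩ hx

theorem mdifferentiableAt_base (Θ : LocalIso n M N) {x : M} (hx : std x ∈ Θ.source) :
    MDifferentiableAt (𝓡 n) (𝓡 n) Θ.base x :=
  (Θ.contMDiffAt_base hx).mdifferentiableAt (by simp)

theorem modelDeriv_trans_base (Θ : LocalIso n M N) (Ξ : LocalIso n N K) {x : M}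
    (hx : std x ∈ (Θ.trans Ξ).source) :
    modelDeriv n (Θ.trans Ξ).base x =
      (modelDeriv n Ξ.base (Θ.base x)).comp (modelDeriv n Θ.base x) := by
  have hΞ : std (Θ.base x) ∈ Ξ.source :=
    Ξ.std_mem_source_iff.2 ((Θ.mem_trans_source Ξ).1 hx).2
  have h : (Θ.trans Ξ).base =ᶠ[𝓝 x] Ξ.base ∘ Θ.base :=
    Filter.eventually_of_mem ((Θ.trans Ξ).isOpen_baseSource.mem_nhds hx)
      fun z hz => Θ.trans_base Ξ hz
  refine Eq.trans (show modelDeriv n (Θ.trans Ξ).base x = modelDeriv n (Ξ.base ∘ Θ.base) x from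
    h.mfderiv_eq) (modelDeriv_comp rfl (Ξ.mdifferentiableAt_base hΞ)
    (Θ.mdifferentiableAt_base ((Θ.mem_trans_source Ξ).1 hx).1))

theorem modelDeriv_base_symm_base (Θ : LocalIso n M N) {x : M} (hx : std x ∈ Θ.source)
    (v : Eucl n) : modelDeriv n Θ.base x (modelDeriv n Θ.symm.base (Θ.base x) v) = v :=
  (Θ.baseDeriv x hx).apply_symm_apply v

/-- The local isomorphism `Ψ⁻¹ ∘ Fτ_v ∘ Φ`. -/
abbrev shift (Φ Ψ : LocalIso n M (Eucl n)) (v : Eucl n) : LocalIso n M M :=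
  (Φ.trans (.ofDiffeomorph (translation v))).trans Ψ.symm

theorem mem_shift_source (Φ Ψ : LocalIso n M (Eucl n)) (v : Eucl n) {x : M} :
    std x ∈ (Φ.shift Ψ v).source ↔ std x ∈ Φ.source ∧ std (Φ.base x + v) ∈ Ψ.target := by
  have h : (lift (translation v) (Φ.map (std x))).proj = Φ.base x + v := rfl
  constructor
  · rintro ⟨⟨h1, -⟩, h2⟩
    exact ⟨h1, (Ψ.symm.mem_source_iff h).1 h2⟩
  · rintro ⟨h1, h2⟩
    exact ⟨⟨h1, mem_univ _⟩, (Ψ.symm.mem_source_iff h).2 h2⟩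

theorem shift_base (Φ Ψ : LocalIso n M (Eucl n)) (v : Eucl n) {x : M}
    (hx : std x ∈ (Φ.shift Ψ v).source) :
    (Φ.shift Ψ v).base x = Ψ.symm.base (Φ.base x + v) :=
  (Φ.trans (.ofDiffeomorph (translation v))).trans_base Ψ.symm hx

theorem modelDeriv_shift_base (Φ Ψ : LocalIso n M (Eucl n)) {x : M} {v w : Eucl n}
    (hw : Φ.base x + v = w) (hx : std x ∈ (Φ.shift Ψ v).source) :
    modelDeriv n (Φ.shift Ψ v).base x =
      (modelDeriv n Ψ.symm.base w).comp (modelDeriv n Φ.base x) := by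
  have hs := (Φ.mem_shift_source Ψ v).1 hx
  have h : (Φ.shift Ψ v).base =ᶠ[𝓝 x] Ψ.symm.base ∘ translation v ∘ Φ.base :=
    Filter.eventually_of_mem ((Φ.shift Ψ v).isOpen_baseSource.mem_nhds hx)
      fun z hz => Φ.shift_base Ψ v hz
  refine Eq.trans (show modelDeriv n (Φ.shift Ψ v).base x =
    modelDeriv n (Ψ.symm.base ∘ translation v ∘ Φ.base) x from h.mfderiv_eq) ?_
  exact modelDeriv_comp_translation_comp hw
    (Ψ.symm.mdifferentiableAt_base (hw ▸ hs.2)) (Φ.mdifferentiableAt_base hs.1)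

end LocalIso

/-! ### The frame and base sections of `R`, and the converse implication -/

namespace NonholonomicSection

theorem exists_jet_eq (R : NonholonomicSection n M) (x y : M) :
    ∃ (Θ : LocalIso n M M) (hx : std x ∈ Θ.source), R.toFun x y = Θ.jet x hx ∧ Θ.base x = y := by
  obtain ⟨Θ, x', hx', h⟩ := (R.toFun x y).exists_jet_eq
  have hs := R.src_eq x y
  have ht := R.tgt_eq x y
  rw [h] at hs ht
  obtain rfl : x' = x := hs
  exact ⟨Θ, hx', h, ht⟩

theorem exists_frame_eq (R : NonholonomicSection n M) (x y : M) :
    ∃ A : TangentSpace (𝓡 n) x ≃L[ℝ] TangentSpace (𝓡 n) y, (R.toFun x y).frame =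
      ⟨x, y, (A : TangentSpace (𝓡 n) x →L[ℝ] TangentSpace (𝓡 n) y)⟩ := by
  obtain ⟨Θ, hx, h, rfl⟩ := R.exists_jet_eq x y
  exact ⟨Θ.fiber x, by rw [h, NonholonomicGroupoid.frame_jet]⟩

theorem exists_baseMap_eq (R : NonholonomicSection n M) (x y : M) :
    ∃ B : TangentSpace (𝓡 n) x ≃L[ℝ] TangentSpace (𝓡 n) y, (R.toFun x y).baseMap =
      ⟨x, y, (B : TangentSpace (𝓡 n) x →L[ℝ] TangentSpace (𝓡 n) y)⟩ := by
  obtain ⟨Θ, hx, h, rfl⟩ := R.exists_jet_eq x y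
  exact ⟨Θ.baseDeriv x hx, by rw [h, NonholonomicGroupoid.baseMap_jet]; rfl⟩

/-- The action of `R (x, y)` on frames. -/
def frameEquiv (R : NonholonomicSection n M) (x y : M) :
    TangentSpace (𝓡 n) x ≃L[ℝ] TangentSpace (𝓡 n) y :=
  Classical.choose (R.exists_frame_eq x y)

/-- The action of `R (x, y)` on tangent vectors of the base. -/
def baseEquiv (R : NonholonomicSection n M) (x y : M) :
    TangentSpace (𝓡 n) x ≃L[ℝ] TangentSpace (𝓡 n) y :=
  Classical.choose (R.exists_baseMap_eq x y)

theorem frame_toFun (R : NonholonomicSection n M) (x y : M) : (R.toFun x y).frame =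
    ⟨x, y, (R.frameEquiv x y : TangentSpace (𝓡 n) x →L[ℝ] TangentSpace (𝓡 n) y)⟩ :=
  Classical.choose_spec (R.exists_frame_eq x y)

theorem baseMap_toFun (R : NonholonomicSection n M) (x y : M) : (R.toFun x y).baseMap =
    ⟨x, y, (R.baseEquiv x y : TangentSpace (𝓡 n) x →L[ℝ] TangentSpace (𝓡 n) y)⟩ :=
  Classical.choose_spec (R.exists_baseMap_eq x y)

theorem frameEquiv_eq (R : NonholonomicSection n M) {x y : M} {Θ : LocalIso n M M}
    {hx : std x ∈ Θ.source} (h : R.toFun x y = Θ.jet x hx) (v : Eucl n) :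
    (R.frameEquiv x y v : Eucl n) = Θ.fiber x v := by
  have h1 := R.frame_toFun x y
  rw [h, NonholonomicGroupoid.frame_jet] at h1
  have h2 := OneJet.lin_eq_of_eq h1
  exact (DFunLike.congr_fun h2 v).symm

theorem baseEquiv_eq (R : NonholonomicSection n M) {x y : M} {Θ : LocalIso n M M}
    {hx : std x ∈ Θ.source} (h : R.toFun x y = Θ.jet x hx) (v : Eucl n) :
    (R.baseEquiv x y v : Eucl n) = modelDeriv n Θ.base x v := by
  have h1 := R.baseMap_toFun x y
  rw [h, NonholonomicGroupoid.baseMap_jet] at h1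
  have h2 := OneJet.lin_eq_of_eq h1
  exact (DFunLike.congr_fun h2 v).symm

theorem exists_comp (R : NonholonomicSection n M) (x y z : M) :
    ∃ (Θ Ξ : LocalIso n M M) (hΘ : std x ∈ Θ.source) (hΞ : std (Θ.base x) ∈ Ξ.source)
      (hΘΞ : std x ∈ (Θ.trans Ξ).source), Θ.base x = y ∧ R.toFun x y = Θ.jet x hΘ ∧
      R.toFun y z = Ξ.jet (Θ.base x) hΞ ∧ R.toFun x z = (Θ.trans Ξ).jet x hΘΞ := by
  obtain ⟨Θ, Ξ, x', hΘ, hΞ, hΘΞ, h1, h2, h3⟩ := R.comp x y z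
  have hs := R.src_eq x y
  have ht := R.tgt_eq x y
  rw [h1] at hs ht
  obtain rfl : x' = x := hs
  exact ⟨Θ, Ξ, hΘ, hΞ, hΘΞ, ht, h1, h2, h3⟩

theorem frameEquiv_trans (R : NonholonomicSection n M) (x y z : M) :
    (R.frameEquiv x y).trans (R.frameEquiv y z) = R.frameEquiv x z := by
  obtain ⟨Θ, Ξ, hΘ, hΞ, hΘΞ, rfl, h1, h2, h3⟩ := R.exists_comp x y z
  refine ContinuousLinearEquiv.ext (funext fun v => ?_)
  exact (R.frameEquiv_eq h2 _).trans ((congrArg (Ξ.fiber (Θ.base x)) (R.frameEquiv_eq h1 v)).trans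
    ((Θ.fiber_trans Ξ hΘΞ v).symm.trans (R.frameEquiv_eq h3 v).symm))

theorem baseEquiv_trans (R : NonholonomicSection n M) (x y z : M) :
    (R.baseEquiv x y).trans (R.baseEquiv y z) = R.baseEquiv x z := by
  obtain ⟨Θ, Ξ, hΘ, hΞ, hΘΞ, rfl, h1, h2, h3⟩ := R.exists_comp x y z
  refine ContinuousLinearEquiv.ext (funext fun v => ?_)
  exact (R.baseEquiv_eq h2 _).trans ((congrArg (modelDeriv n Ξ.base (Θ.base x))
    (R.baseEquiv_eq h1 v)).trans ((DFunLike.congr_fun (Θ.modelDeriv_trans_base Ξ hΘΞ) v).symm.trans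
      (R.baseEquiv_eq h3 v).symm))

/-- `R` is given by `Ψ⁻¹ ∘ Fτ ∘ Φ` on `U × V`. -/
def IsShiftOn (R : NonholonomicSection n M) (U V : Set M) (Φ Ψ : LocalIso n M (Eucl n)) : Prop :=
  ∀ x ∈ U, ∀ y ∈ V, ∃ hx, R.toFun x y = (Φ.shift Ψ (Ψ.base y - Φ.base x)).jet x hx

variable {R : NonholonomicSection n M} {U V : Opens M} {Φ Ψ : LocalIso n M (Eucl n)}

/-- Apply the shift representing `R (x, y)` to a section of frames whose matrix is the identity near
`x₀`: the matrix of the image is that of the action of `R (x, y)`, and the image depends smoothly on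
`(x, y)`. -/
theorem smoothAt_frameEquiv (hΦ : Φ.source = proj ⁻¹' U) (hΨ : Ψ.source = proj ⁻¹' V)
    (hR : R.IsShiftOn U V Φ Ψ) {x₀ y₀ : M} (hx₀ : x₀ ∈ U) (hy₀ : y₀ ∈ V) :
    OneJet.SmoothAt ((𝓡 n).prod (𝓡 n))
      (fun q : M × M => (⟨q.1, q.2, R.frameEquiv q.1 q.2⟩ : OneJet (𝓡 n) M)) (x₀, y₀) := by
  have hsx : (std x₀ : FrameBundle n M) ∈ Φ.source := hΦ ▸ hx₀
  have hsy : (std y₀ : FrameBundle n M) ∈ Ψ.source := hΨ ▸ hy₀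
  refine ⟨contMDiffAt_fst, contMDiffAt_snd, ?_⟩
  let v : M × M → Eucl n := fun q => Ψ.base q.2 - Φ.base q.1
  let σ : M × M → FrameBundle n M := fun q => constSection (std x₀) q.1
  have hσ₀ : σ (x₀, y₀) = std x₀ := constSection_self (std x₀)
  have hσ : ContMDiffAt ((𝓡 n).prod (𝓡 n)) (FModel n) ∞ σ (x₀, y₀) :=
    ContMDiffAt.comp (x₀, y₀) (contMDiffAt_constSection (std x₀ : FrameBundle n M)) contMDiffAt_fst
  have hφ : ContMDiffAt ((𝓡 n).prod (𝓡 n)) (𝓡 n) ∞ (fun q : M × M => Φ.base q.1) (x₀, y₀) :=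
    ContMDiffAt.comp (x₀, y₀) (g := Φ.base) (Φ.contMDiffAt_base hsx) contMDiffAt_fst
  have hψ : ContMDiffAt ((𝓡 n).prod (𝓡 n)) (𝓡 n) ∞ (fun q : M × M => Ψ.base q.2) (x₀, y₀) :=
    ContMDiffAt.comp (x₀, y₀) (g := Ψ.base) (Ψ.contMDiffAt_base hsy) contMDiffAt_snd
  have hv : ContMDiffAt ((𝓡 n).prod (𝓡 n)) (𝓡 n) ∞ v (x₀, y₀) := hψ.sub hφ
  have hΦσ : ContMDiffAt ((𝓡 n).prod (𝓡 n)) (FModel n) ∞ (fun q => Φ.map (σ q)) (x₀, y₀) := by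
    refine ContMDiffAt.comp (x₀, y₀) (g := Φ.map) ?_ hσ
    rw [hσ₀]
    exact Φ.contMDiffAt_map hsx
  obtain ⟨hs₀, hR₀⟩ := hR x₀ hx₀ y₀ hy₀
  have hY : ContMDiffAt ((𝓡 n).prod (𝓡 n)) (FModel n) ∞
      (fun q => (Φ.shift Ψ (v q)).map (σ q)) (x₀, y₀) := by
    refine ContMDiffAt.comp (x₀, y₀) (g := Ψ.symm.map) ?_ (contMDiffAt_lift_translation hv hΦσ)
    refine Ψ.symm.contMDiffAt_map ?_
    rw [hσ₀]
    exact hs₀.2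
  have hproj : ∀ q : M × M, q.1 ∈ U → q.2 ∈ V →
      σ q ∈ (Φ.shift Ψ (v q)).source ∧ ((Φ.shift Ψ (v q)).map (σ q)).proj = q.2 := by
    intro q h1 h2
    obtain ⟨hs, hq⟩ := hR q.1 h1 q.2 h2
    have hm : σ q ∈ (Φ.shift Ψ (v q)).source :=
      (LocalIso.mem_source_iff _ (proj_constSection _ _)).2 hs
    refine ⟨hm, ?_⟩
    have ht := R.tgt_eq q.1 q.2
    rw [hq] at ht
    rw [LocalIso.proj_map _ hm, proj_constSection]
    exact ht
  have hc := (contMDiffAt_frameBundle_iff.1 hY).2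
  rw [(hproj (x₀, y₀) hx₀ hy₀).2] at hc
  refine hc.congr_of_eventuallyEq ?_
  filter_upwards [eventually_mem_tanTriv (n := n)
      (continuousAt_fst : ContinuousAt (Prod.fst : M × M → M) (x₀, y₀)),
    continuousAt_fst.preimage_mem_nhds (U.isOpen.mem_nhds hx₀),
    continuousAt_snd.preimage_mem_nhds (V.isOpen.mem_nhds hy₀)] with q hq h1 h2
  obtain ⟨hm, hp⟩ := hproj q h1 h2
  obtain ⟨hs, hRq⟩ := hR q.1 h1 q.2 h2
  have hcoord : coord x₀ (constSection (std x₀) q.1) = ContinuousLinearMap.id ℝ (Eucl n) :=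
    (coord_constSection (std x₀ : FrameBundle n M) hq).trans (coord_std x₀)
  have h3 := coord_eq_inCoordinates_comp (A := R.frameEquiv q.1 q.2) (x₀ := x₀) (y₀ := y₀)
    (proj_constSection (std x₀ : FrameBundle n M) q.1) hp (fun w =>
      (LocalIso.iso_map _ hm (proj_constSection _ _) w).trans (R.frameEquiv_eq hRq _).symm) hq
  rw [hcoord, ContinuousLinearMap.comp_id] at h3
  exact h3.symm

/-- The base action at `(x, y)` is the derivative at `z = x` of `ψ⁻¹ (φ z + ψ y - φ x)`. This map is
smooth in `(x, y, z)` jointly, so its partial derivative in `z` is smooth in the parameters. -/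
theorem smoothAt_baseEquiv (hΦ : Φ.source = proj ⁻¹' U) (hΨ : Ψ.source = proj ⁻¹' V)
    (hR : R.IsShiftOn U V Φ Ψ) {x₀ y₀ : M} (hx₀ : x₀ ∈ U) (hy₀ : y₀ ∈ V) :
    OneJet.SmoothAt ((𝓡 n).prod (𝓡 n))
      (fun q : M × M => (⟨q.1, q.2, R.baseEquiv q.1 q.2⟩ : OneJet (𝓡 n) M)) (x₀, y₀) := by
  have hsx : (std x₀ : FrameBundle n M) ∈ Φ.source := hΦ ▸ hx₀
  have hsy : ∀ y ∈ V, (std y : FrameBundle n M) ∈ Ψ.source := fun y hy => hΨ ▸ hy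
  refine ⟨contMDiffAt_fst, contMDiffAt_snd, ?_⟩
  have hadd : ∀ a b : Eucl n, a + (b - a) = b := fun a b => by abel
  let F : M × M → M → M := fun q z => Ψ.symm.base (Φ.base z + (Ψ.base q.2 - Φ.base q.1))
  have hFq : ∀ q : M × M, q.2 ∈ V → F q q.1 = q.2 := fun q hq => by
    simp only [F]
    rw [hadd]
    exact Ψ.symm_base_base (hsy _ hq)
  have hF : ContMDiffAt (((𝓡 n).prod (𝓡 n)).prod (𝓡 n)) (𝓡 n) ∞ (Function.uncurry F)
      ((x₀, y₀), x₀) := by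
    refine ContMDiffAt.comp ((x₀, y₀), x₀) (I' := 𝓡 n) (g := Ψ.symm.base)
      (f := fun p : (M × M) × M => Φ.base p.2 + (Ψ.base p.1.2 - Φ.base p.1.1)) ?_ ?_
    · refine Ψ.symm.contMDiffAt_base ?_
      change std (Φ.base x₀ + (Ψ.base y₀ - Φ.base x₀)) ∈ Ψ.target
      rw [hadd]
      exact Ψ.base_mem_target (hsy y₀ hy₀)
    · have h1 : ContMDiffAt (((𝓡 n).prod (𝓡 n)).prod (𝓡 n)) (𝓡 n) ∞
          (fun p : (M × M) × M => Φ.base p.2) ((x₀, y₀), x₀) :=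
        ContMDiffAt.comp ((x₀, y₀), x₀) (g := Φ.base) (Φ.contMDiffAt_base hsx) contMDiffAt_snd
      have h2 : ContMDiffAt (((𝓡 n).prod (𝓡 n)).prod (𝓡 n)) (𝓡 n) ∞
          (fun p : (M × M) × M => Ψ.base p.1.2) ((x₀, y₀), x₀) :=
        ContMDiffAt.comp ((x₀, y₀), x₀) (g := Ψ.base) (Ψ.contMDiffAt_base (hsy y₀ hy₀))
          (contMDiff_snd.comp contMDiff_fst).contMDiffAt
      have h3 : ContMDiffAt (((𝓡 n).prod (𝓡 n)).prod (𝓡 n)) (𝓡 n) ∞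
          (fun p : (M × M) × M => Φ.base p.1.1) ((x₀, y₀), x₀) :=
        ContMDiffAt.comp ((x₀, y₀), x₀) (g := Φ.base) (Φ.contMDiffAt_base hsx)
          (contMDiff_fst.comp contMDiff_fst).contMDiffAt
      exact h1.add (h2.sub h3)
  have hd := ContMDiffAt.mfderiv (m := ∞) F Prod.fst hF contMDiffAt_fst (by simp)
  refine hd.congr_of_eventuallyEq ?_
  filter_upwards [continuousAt_fst.preimage_mem_nhds (U.isOpen.mem_nhds hx₀),
    continuousAt_snd.preimage_mem_nhds (V.isOpen.mem_nhds hy₀)] with q h1 h2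
  refine inTangentCoordinates_congr rfl rfl (hFq (x₀, y₀) hy₀) (hFq q h2) ?_
  obtain ⟨hs, hRq⟩ := hR q.1 h1 q.2 h2
  have h : (Φ.shift Ψ (Ψ.base q.2 - Φ.base q.1)).base =ᶠ[𝓝 q.1] F q :=
    Filter.eventually_of_mem ((Φ.shift Ψ _).isOpen_baseSource.mem_nhds hs)
      fun z hz => Φ.shift_base Ψ _ hz
  refine ContinuousLinearMap.ext fun w => (R.baseEquiv_eq hRq w).trans ?_
  exact DFunLike.congr_fun (show modelDeriv n (Φ.shift Ψ (Ψ.base q.2 - Φ.base q.1)).base q.1 =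
    modelDeriv n (F q) q.1 from h.mfderiv_eq) w

/-- If `R` is given by `Ψ⁻¹ ∘ Fτ ∘ Φ` near the diagonal, then `φ` is an affine chart for its base
section. -/
theorem jet_eq_oneJet_base (hΦ : Φ.source = proj ⁻¹' U)
    (hR : R.IsShiftOn U V Φ Ψ) {Q : PiSection n M} (hQ : Q.toFun = R.baseEquiv) {x y : M}
    (hxU : x ∈ U) (hyU : y ∈ U) (hyV : y ∈ V) :
    Q.jet x y =
      oneJet (𝓡 n) (Φ.symm.base ∘ translation (Φ.base y - Φ.base x) ∘ Φ.base) x := by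
  have hsU : ∀ z ∈ U, (std z : FrameBundle n M) ∈ Φ.source := fun z hz => hΦ ▸ hz
  have hadd : ∀ a b : Eucl n, a + (b - a) = b := fun a b => by abel
  have hB : ∀ z ∈ U, ∀ w : Eucl n, (Q.toFun z y w : Eucl n) =
      modelDeriv n Ψ.symm.base (Ψ.base y) (modelDeriv n Φ.base z w) := by
    intro z hz w
    obtain ⟨hs, hRz⟩ := hR z hz y hyV
    rw [hQ]
    exact (R.baseEquiv_eq hRz w).trans
      (DFunLike.congr_fun (Φ.modelDeriv_shift_base Ψ (hadd _ _) hs) w)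
  refine OneJet.ext_model rfl ?_ ?_
  · change y = Φ.symm.base (Φ.base x + (Φ.base y - Φ.base x))
    rw [hadd, Φ.symm_base_base (hsU y hyU)]
  refine ContinuousLinearMap.ext fun w => ?_
  have h1 := DFunLike.congr_fun (modelDeriv_comp_translation_comp (hadd (Φ.base x) (Φ.base y))
    (Φ.symm.mdifferentiableAt_base (Φ.base_mem_target (hsU y hyU)))
    (Φ.mdifferentiableAt_base (hsU x hxU))) w
  refine Eq.trans ?_ h1.symm
  refine (hB x hxU w).trans ?_
  set u : Eucl n := modelDeriv n Φ.base x w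
  -- The formula for `Q (z, y)` at `z = y`, where `Q (y, y) = id`, shows that `ψ⁻¹` and `φ⁻¹` have
  -- the same derivative at the images of `y`.
  have h2 := hB y hyU (modelDeriv n Φ.symm.base (Φ.base y) u)
  rw [Φ.modelDeriv_base_symm_base (hsU y hyU)] at h2
  exact h2.symm.trans (Q.toFun_self y _)

theorem isIntegrableProlongation_of_isShiftOn
    (h : ∀ x₀ y₀ : M, ∃ (U V : Opens M) (Φ Ψ : LocalIso n M (Eucl n)), x₀ ∈ U ∧ y₀ ∈ V ∧
      Φ.source = proj ⁻¹' U ∧ Ψ.source = proj ⁻¹' V ∧ R.IsShiftOn U V Φ Ψ) :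
    R.IsIntegrableProlongation := by
  let P : PiSection n M :=
    { toFun := R.frameEquiv
      smooth := fun p => by
        obtain ⟨U, V, Φ, Ψ, hx, hy, hΦ, hΨ, hR⟩ := h p.1 p.2
        exact smoothAt_frameEquiv hΦ hΨ hR hx hy
      comp := R.frameEquiv_trans }
  let Q : PiSection n M :=
    { toFun := R.baseEquiv
      smooth := fun p => by
        obtain ⟨U, V, Φ, Ψ, hx, hy, hΦ, hΨ, hR⟩ := h p.1 p.2
        exact smoothAt_baseEquiv hΦ hΨ hR hx hy
      comp := R.baseEquiv_trans }
  refine ⟨P, Q, fun x y => ?_, fun x₀ => ?_⟩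
  · obtain ⟨U, V, Φ, Ψ, hx, hy, hΦ, hΨ, hR⟩ := h x y
    obtain ⟨hs, hRxy⟩ := hR x hx y hy
    set v : Eucl n := Ψ.base y - Φ.base x
    refine ⟨(Φ.shift Ψ v).baseHomeo, Φ.shift Ψ v, LocalIso.contMDiffOn_baseHomeo _,
      LocalIso.contMDiffOn_baseHomeo_symm _, hs, ?_, ?_, fun X hX => ?_, hs, hRxy⟩
    · have h1 := R.baseMap_toFun x y
      rw [hRxy, NonholonomicGroupoid.baseMap_jet] at h1
      exact h1.symm
    · exact Set.ext fun X => (LocalIso.std_mem_source_iff _).symm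
    · have hsX : std X.proj ∈ (Φ.shift Ψ v).source := (LocalIso.std_mem_source_iff _).2 hX
      have hm := (Φ.mem_shift_source Ψ v).1 hsX
      have hw : (Φ.shift Ψ v).base X.proj = Ψ.symm.base (Φ.base X.proj + v) :=
        Φ.shift_base Ψ v hsX
      have hz : X.proj ∈ U := by
        have h1 : std X.proj ∈ proj ⁻¹' (U : Set M) := hΦ ▸ hm.1
        exact h1
      have hwV : (Φ.shift Ψ v).base X.proj ∈ V := by
        have h1 : std (Ψ.symm.base (Φ.base X.proj + v)) ∈ Ψ.source :=
          Ψ.symm.base_mem_target hm.2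
        rw [hΨ] at h1
        rw [hw]
        exact h1
      -- The shift by `v` chosen for `(x, y)` is also the one that represents `R` at `(z, w)`, for
      -- every `z` in its domain with image `w`. Its action on the frames at `z` is therefore `P (z,
      -- w)`.
      have hv : Ψ.base ((Φ.shift Ψ v).base X.proj) - Φ.base X.proj = v := by
        rw [hw, show Ψ.base (Ψ.symm.base (Φ.base X.proj + v)) = Φ.base X.proj + v from
          Ψ.symm.symm_base_base hm.2]
        abel
      have hRX := hR X.proj hz _ hwV
      rw [hv] at hRX
      obtain ⟨hs', hRX⟩ := hRX
      refine ((Φ.shift Ψ v).map_eq hX).trans (ext_mk rfl fun w => ?_)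
      exact (R.frameEquiv_eq hRX (X.iso w)).symm
  · obtain ⟨U, V, Φ, Ψ, hx, hy, hΦ, hΨ, hR⟩ := h x₀ x₀
    have hs : (std x₀ : FrameBundle n M) ∈ Φ.source := hΦ ▸ hx
    have hU : ∀ z, (std z : FrameBundle n M) ∈ Φ.source → z ∈ U := fun z hz => by
      rw [hΦ] at hz
      exact hz
    -- `φ` is restricted to `U ∩ V` because comparing `φ` with `ψ` at `y` requires `(y, y) ∈ U × V`.
    refine ⟨Φ.baseHomeo.restrOpen V V.isOpen, mem_maximalAtlas_of_contMDiffOn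
      (Φ.contMDiffOn_baseHomeo.mono fun _ hz => hz.1)
      (Φ.contMDiffOn_baseHomeo_symm.mono fun _ hz => hz.1), ⟨hs, hy⟩,
      fun x hx y hy => ?_⟩
    exact jet_eq_oneJet_base hΦ hR rfl (hU x hx.1) (hU y hy.1) hy.2

end NonholonomicSection

end NonHol

end

open NonHol
theorem mainTheorem10 (n : ℕ) (M : Type*) [TopologicalSpace M] [ChartedSpace (Eucl n) M]
    [IsManifold (𝓡 n) ∞ M] (R : NonholonomicSection n M) :
    R.IsIntegrableProlongation ↔
      ∀ x₀ y₀ : M, ∃ (U V : Opens M) (U' V' : Opens (Eucl n))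
        (Φ Ψ : LocalIso n M (Eucl n)),
        x₀ ∈ U ∧ y₀ ∈ V ∧
        Φ.source = FrameBundle.proj ⁻¹' U ∧ Φ.target = FrameBundle.proj ⁻¹' U' ∧
        Ψ.source = FrameBundle.proj ⁻¹' V ∧ Ψ.target = FrameBundle.proj ⁻¹' V' ∧
        ∀ x ∈ U, ∀ y ∈ V, ∃ hx,
          R.toFun x y =
            ((Φ.trans (.ofDiffeomorph (translation (Ψ.base y - Φ.base x)))).trans Ψ.symm).jet x hx := by
  refine ⟨fun h => h.exists_localIso, fun h => ?_⟩
  refine NonholonomicSection.isIntegrableProlongation_of_isShiftOn fun x₀ y₀ => ?_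
  obtain ⟨U, V, -, -, Φ, Ψ, hx, hy, hΦ, -, hΨ, -, hR⟩ := h x₀ y₀
  exact ⟨U, V, Φ, Ψ, hx, hy, hΦ, hΨ, hR⟩
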